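/- Let $m,n\ge 1$ be integers with $\gcd(m,n)=1$, and put $d=m+n$. Fix norms on $\mathbb{R}^m$ and $\mathbb{R}^n$, and define $F:\mathbb{R}^d=\mathbb{R}^m\oplus\mathbb{R}^n\to[0,\infty)$ by $F(v,w)=\|v\|^m\|w\|^n$. For $t\in\mathbb{R}$ let $h_t=\mathrm{diag}(e^{nt}I_m,e^{-mt}I_n)\in \mathrm{SL}_d(\mathbb{R})$. Let $X\cong \mathrm{SL}_d(\mathbb{R})/\mathrm{SL}_d(\mathbb{Z})$ be the space of unimodular lattices in $\mathbb{R}^d$, and let $Y\cong \mathrm{ASL}_d(\mathbb{R})/\mathrm{ASL}_d(\mathbb{Z})$ be the space of unimodular grids, i.e. of the sets $x+v=\{u+v:u\in x\}$ with $x\in X$ and $v\in\mathbb{R}^d$, both with the quotient topology. A point of the torus $\mathbb{R}^d/x$ is a coset of $x$ in $\mathbb{R}^d$, hence a grid in $Y$. For $x\in X$ let $\partial(x)$ be the set of all $z\in X$ for which there is an unbounded sequence $t_k\ge 0$ with $h_{t_k}x\to z$. An accumulation sequence of length $d$ for $x$ is a sequence $(x_0,x_1,\dots,x_{d-1})$ in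 $X$ with $x_0=x$ and $x_{i+1}\in\partial(x_i)$ for $0\le i\le d-2$. A linear subspace $U\subset\mathbb{R}^d$ is $x$-rational if $U\cap x$ contains a basis of $U$. A non-trivial algebraic measure on $\mathbb{R}^d/x$ is the $U$-invariant Borel probability measure supported on a coset $x+v+U$ in $\mathbb{R}^d/x$, where $U\ne\{0\}$ is an $x$-rational subspace and $v\in\mathbb{R}^d$. For $x'\in X$, a coset of a $(d-1)$-dimensional subtorus of $\mathbb{R}^d/x'$ is a set $\{x'+v+u:u\in U\}$, where $U$ is an $x'$-rational subspace of dimension $d-1$ and $v\in\mathbb{R}^d$. **Theorem.** Let $x\in X$ have an accumulation sequence $(x_0,\dots,x_{d-1})$ of length $d$, and let $\mu$ be a non-trivial algebraic measure on $\mathbb{R}^d/x$. Then $\mu$-almost every grid $y\in\mathbb{R}^d/x$ is $DV_F$, i.e. $\overline{\{F(u):u\in y\}}=[0,\infty)$. In fact, for $\mu$-almost every $y$ the orbit closure $\overline{\{h_ty:t\ge0\}}\subset Y$ contains a coset of a $(d-1)$-dimensional subtorus of $\mathbb{R}^d/x_{d-1}$. -/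

import Mathlib

open Filter Topology MeasureTheory

noncomputable section

namespace Grids

/-- `ℝ^d = ℝ^m ⊕ ℝ^n`, where `d = m + n`; the first `m` coordinates are indexed by `Sum.inl`,
the last `n` by `Sum.inr`. -/
abbrev Vec (m n : ℕ) : Type := Fin m ⊕ Fin n → ℝ

/-- The group `SL_d(ℝ)`, with Mathlib's topology (induced from the matrices). -/
abbrev SLd (m n : ℕ) : Type := Matrix.SpecialLinearGroup (Fin m ⊕ Fin n) ℝ

/-- Action of `g ∈ SL_d(ℝ)` on column vectors. -/
def lin {m n : ℕ} (g : SLd m n) : Vec m n →+ Vec m n :=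
  (Matrix.mulVecLin (g : Matrix (Fin m ⊕ Fin n) (Fin m ⊕ Fin n) ℝ)).toAddMonoidHom

/-- The standard lattice `ℤ^d`. -/
def stdLattice (m n : ℕ) : AddSubgroup (Vec m n) :=
  ((Int.castAddHom ℝ).compLeft (Fin m ⊕ Fin n)).range

/-- The lattice `g ℤ^d`. -/
def latticeOf {m n : ℕ} (g : SLd m n) : AddSubgroup (Vec m n) :=
  (stdLattice m n).map (lin g)

/-- The space `X` of unimodular lattices of `ℝ^d`: the subgroups `g ℤ^d` with `g ∈ SL_d(ℝ)`. -/
def Lattice (m n : ℕ) : Type := {x : AddSubgroup (Vec m n) // ∃ g : SLd m n, latticeOf g = x}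

/-- The lattice `g ℤ^d`, as a point of `X`. -/
def Lattice.of {m n : ℕ} (g : SLd m n) : Lattice m n := ⟨latticeOf g, g, rfl⟩

/-- The topology of `X ≃ SL_d(ℝ) / SL_d(ℤ)`: the quotient topology for `g ↦ g ℤ^d`. -/
instance (m n : ℕ) : TopologicalSpace (Lattice m n) :=
  TopologicalSpace.coinduced Lattice.of inferInstance

/-- The grid `g ℤ^d + v`. -/
def gridOf {m n : ℕ} (g : SLd m n) (v : Vec m n) : Set (Vec m n) :=
  {w | ∃ u ∈ latticeOf g, u + v = w}

/-- The space `Y` of unimodular grids of `ℝ^d`: the subsets `g ℤ^d + v` of `ℝ^d`. -/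
def Grid (m n : ℕ) : Type :=
  {y : Set (Vec m n) // ∃ (g : SLd m n) (v : Vec m n), gridOf g v = y}

/-- The grid `g ℤ^d + v`, as a point of `Y`. -/
def Grid.of {m n : ℕ} (p : SLd m n × Vec m n) : Grid m n := ⟨gridOf p.1 p.2, p.1, p.2, rfl⟩

/-- The topology of `Y ≃ ASL_d(ℝ) / ASL_d(ℤ)`: the quotient topology for `(g, v) ↦ g ℤ^d + v`
(as a topological space, `ASL_d(ℝ)` is `SL_d(ℝ) × ℝ^d`). -/
instance (m n : ℕ) : TopologicalSpace (Grid m n) :=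
  TopologicalSpace.coinduced Grid.of inferInstance

theorem lin_mul {m n : ℕ} (g h : SLd m n) : lin (g * h) = (lin g).comp (lin h) := by
  refine AddMonoidHom.ext fun v => ?_
  simp [lin, Matrix.mulVec_mulVec]

theorem latticeOf_mul {m n : ℕ} (g h : SLd m n) :
    latticeOf (g * h) = (latticeOf h).map (lin g) := by
  simp [latticeOf, AddSubgroup.map_map, lin_mul]

/-- The action of `SL_d(ℝ)` on lattices: `(g, x) ↦ g x`. -/
def Lattice.act {m n : ℕ} (g : SLd m n) (x : Lattice m n) : Lattice m n :=
  ⟨x.1.map (lin g), by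
    obtain ⟨_, h, rfl⟩ := x
    exact ⟨g * h, latticeOf_mul g h⟩⟩

/-- The action of `SL_d(ℝ)` on grids: `(g, y) ↦ g y`. -/
def Grid.act {m n : ℕ} (g : SLd m n) (y : Grid m n) : Grid m n :=
  ⟨lin g '' y.1, by
    obtain ⟨_, h, v, rfl⟩ := y
    refine ⟨g * h, lin g v, ?_⟩
    ext w
    simp only [gridOf, latticeOf_mul, AddSubgroup.mem_map, Set.mem_ofPred_eq, Set.mem_image]
    constructor
    · rintro ⟨_, ⟨u, hu, rfl⟩, rfl⟩
      exact ⟨u + v, ⟨u, hu, rfl⟩, map_add _ _ _⟩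
    · rintro ⟨_, ⟨u, hu, rfl⟩, rfl⟩
      exact ⟨_, ⟨u, hu, rfl⟩, (map_add _ _ _).symm⟩⟩

/-- `h_t = diag(e^{nt} I_m, e^{-mt} I_n)`. -/
def flow (m n : ℕ) (t : ℝ) : SLd m n :=
  ⟨Matrix.fromBlocks (Real.exp (n * t) • (1 : Matrix (Fin m) (Fin m) ℝ)) 0 0
    (Real.exp (-(m * t)) • (1 : Matrix (Fin n) (Fin n) ℝ)), by
    rw [Matrix.det_fromBlocks_zero₁₂, Matrix.det_smul, Matrix.det_smul]
    simp only [Fintype.card_fin, Matrix.det_one, mul_one]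
    rw [← Real.exp_nat_mul, ← Real.exp_nat_mul, ← Real.exp_add]
    ring_nf
    simp⟩

/-- The set `∂(x)` of asymptotic accumulation points of `x`: the limits of `h_{t_k} x` along
unbounded sequences `t_k ≥ 0`. -/
def boundary {m n : ℕ} (x : Lattice m n) : Set (Lattice m n) :=
  {y | ∃ t : ℕ → ℝ, (∀ k, 0 ≤ t k) ∧ ¬ BddAbove (Set.range t) ∧
    Tendsto (fun k => Lattice.act (flow m n (t k)) x) atTop (𝓝 y)}

/-- `(x_0, …, x_k)` is an accumulation sequence, of length `k + 1`, for `x`. -/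
def IsAccumulationSequence {m n k : ℕ} (x : Lattice m n) (s : Fin (k + 1) → Lattice m n) : Prop :=
  s 0 = x ∧ ∀ i : Fin k, s i.succ ∈ boundary (s i.castSucc)

/-- The torus `ℝ^d / x`, with Mathlib's topology and measurable structure on quotient groups. -/
abbrev Torus {m n : ℕ} (x : Lattice m n) : Type := Vec m n ⧸ x.1

/-- A point of the torus `ℝ^d / x` is a coset `x + v`, that is, a grid. -/
def Torus.toGrid {m n : ℕ} (x : Lattice m n) (y : Torus x) : Grid m n :=
  ⟨{w | (QuotientAddGroup.mk w : Torus x) = y}, by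
    obtain ⟨_, g, rfl⟩ := x
    obtain ⟨v, rfl⟩ := QuotientAddGroup.mk_surjective y
    refine ⟨g, v, ?_⟩
    ext w
    simp only [gridOf, Set.mem_ofPred_eq]
    constructor
    · rintro ⟨u, hu, rfl⟩
      refine (QuotientAddGroup.eq.2 ?_).symm
      simpa using hu
    · intro h
      exact ⟨-v + w, QuotientAddGroup.eq.1 h.symm, by abel⟩⟩

/-- A linear subspace `U` of `ℝ^d` is `x`-rational if `U ∩ x` contains a basis of `U`,
that is, if `U ∩ x` spans `U`. -/
def IsRational {m n : ℕ} (x : Lattice m n) (U : Submodule ℝ (Vec m n)) : Prop :=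
  Submodule.span ℝ ((U : Set (Vec m n)) ∩ (x.1 : Set (Vec m n))) = U

/-- The coset `x + v + U` in `ℝ^d / x` of the image of `U`. It is a coset of a subtorus of
dimension `dim U` if `U` is `x`-rational. -/
def coset {m n : ℕ} (x : Lattice m n) (U : Submodule ℝ (Vec m n)) (v : Vec m n) : Set (Torus x) :=
  {y | ∃ u ∈ U, (QuotientAddGroup.mk (v + u) : Torus x) = y}

/-- `μ` is a non-trivial algebraic measure on `ℝ^d / x`: for some `x`-rational subspace `U ≠ 0`,
it is the `U`-invariant probability measure on a coset `x + v + U`. -/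
def IsNontrivialAlgebraic {m n : ℕ} (x : Lattice m n) (μ : Measure (Torus x)) : Prop :=
  IsProbabilityMeasure μ ∧ ∃ (U : Submodule ℝ (Vec m n)) (v : Vec m n),
    U ≠ ⊥ ∧ IsRational x U ∧ μ (coset x U v)ᶜ = 0 ∧
      ∀ u ∈ U, μ.map (fun y => y + (QuotientAddGroup.mk u : Torus x)) = μ

/-- `F(v, w) = ‖v‖^m ‖w‖^n`, for given norms on `ℝ^m` and `ℝ^n`; it is invariant under `h_t`. -/
def F {m n : ℕ} (N₁ : Seminorm ℝ (Fin m → ℝ)) (N₂ : Seminorm ℝ (Fin n → ℝ)) (u : Vec m n) : ℝ :=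
  N₁ (fun i => u (Sum.inl i)) ^ m * N₂ (fun j => u (Sum.inr j)) ^ n

/-- The grid `y` is `DV_F`: the closure of the value set `V_F(y) = {F(u) : u ∈ y}` is `[0, ∞)`. -/
def IsDV {m n : ℕ} (N₁ : Seminorm ℝ (Fin m → ℝ)) (N₂ : Seminorm ℝ (Fin n → ℝ)) (y : Grid m n) :
    Prop :=
  closure (F N₁ N₂ '' y.1) = Set.Ici 0

/-- The closure in `Y` of the forward orbit `{h_t y : t ≥ 0}`. -/
def orbitClosure {m n : ℕ} (y : Grid m n) : Set (Grid m n) :=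
  closure {z | ∃ t : ℝ, 0 ≤ t ∧ Grid.act (flow m n t) y = z}

end Grids

end

/-!
# Grids with dense values along accumulation sequences

Write `d = m + n` and `x = g₀ ℤ^d`. If `h_{t_j} x → z = g₁ ℤ^d` with `t_j → ∞`, then the convergence
lifts to the group: `h_{t_j} g₀ = g_j γ_j` with `g_j → g₁` and `γ_j ∈ SL_d(ℤ)`
(`exists_lift_of_mem_boundary`). Grids over `g ℤ^d` correspond to points of `ℝ^d / ℤ^d` (`gridAt`),
and `h_{t_j}` acts on these points as `γ_j`. So everything is about limits of points and subtori of
the standard torus under the integer matrices `γ_j`.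

Probability measures on the torus whose Fourier coefficients outside a set `S` of characters tend
to zero become invariant under the annihilator `S^⊥`, hence do not lose their mass near a whole
coset of `S^⊥` (`exists_translate_not_tendsto_zero`). This is applied twice.

* To the empirical measures of a random point of the torus. Characters whose frequencies under
  `γ_j` do not stay constant average to zero almost surely, so almost every orbit accumulates at a
  coset of a nontrivial subtorus over the first accumulation point
  (`exists_ae_forall_mapClusterPt`, `ae_containsCoset_one`).
* To the invariant measures of the images of a coset of a subtorus of dimension `e`, where
  `0 < e < d`. The limit contains a coset of dimension `e + 1`, unless the images of the rational
  subspace stay constant (`exists_larger_limit_coset`). They do not: `h_t` multiplies each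
  `e × e` minor by `exp (ω t)` with `ω = (m + n) a - m e`, which is nonzero as `gcd(m, n) = 1`,
  while integrality of minors keeps the covolume bounded away from zero and infinity
  (`not_eventually_span_eq`).

So each step of the accumulation sequence raises the dimension by one, and over the last lattice
one obtains a coset of dimension `d - 1`. Together with its translates by the lattice it contains
an affine hyperplane that misses the origin, on which `F` takes all values in `[0, ∞)`; these are
limits of values on the original grid, as `F` is invariant under the flow
(`isDV_of_coset_subset`).
-/

noncomputable section

namespace Grids

open scoped Matrix

/-! ### Fourier analysis on the torus -/

section Torus

variable {ι : Type*}

/-- The projection `ℝ^ι → ℝ^ι / ℤ^ι`. -/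
def toTorus (v : ι → ℝ) : UnitAddTorus ι := fun i => (v i : UnitAddCircle)

theorem toTorus_add (v w : ι → ℝ) : toTorus (v + w) = toTorus v + toTorus w := rfl

theorem isOpenQuotientMap_toTorus : IsOpenQuotientMap (toTorus : (ι → ℝ) → UnitAddTorus ι) :=
  IsOpenQuotientMap.piMap fun _ => QuotientAddGroup.isOpenQuotientMap_mk

theorem toTorus_eq_iff {v w : ι → ℝ} :
    toTorus v = toTorus w ↔ ∃ p : ι → ℤ, w = v + fun i => (p i : ℝ) := by
  constructor
  · intro h
    have h1 : ∀ i, ∃ p : ℤ, w i = v i + p := fun i => by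
      have h2 : ((w i - v i : ℝ) : UnitAddCircle) = 0 := by
        rw [AddCircle.coe_sub, sub_eq_zero]
        exact (congrFun h i).symm
      obtain ⟨p, hp⟩ := (AddCircle.coe_eq_zero_iff _).1 h2
      exact ⟨p, by simp at hp; linarith⟩
    choose p hp using h1
    exact ⟨p, funext hp⟩
  · rintro ⟨p, rfl⟩
    funext i
    have h : (((p i : ℤ) : ℝ) : UnitAddCircle) = 0 :=
      (AddCircle.coe_eq_zero_iff _).2 ⟨p i, by simp⟩
    simp only [toTorus, Pi.add_apply, AddCircle.coe_add, h, add_zero]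

variable [Fintype ι]

theorem mFourier_apply (ξ : ι → ℤ) (z : UnitAddTorus ι) :
    UnitAddTorus.mFourier ξ z = (AddCircle.toCircle (∑ i, ξ i • z i) : ℂ) := by
  have : ∀ s : Finset ι, ∏ i ∈ s, fourier (ξ i) (z i) =
      (AddCircle.toCircle (∑ i ∈ s, ξ i • z i) : ℂ) := by
    classical
    intro s
    induction s using Finset.induction_on with
    | empty => simp
    | insert a s ha ih =>
      rw [Finset.prod_insert ha, ih, Finset.sum_insert ha, AddCircle.toCircle_add, fourier_apply,
        Circle.coe_mul]
  exact this Finset.univ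

theorem mFourier_add_apply (ξ : ι → ℤ) (z w : UnitAddTorus ι) :
    UnitAddTorus.mFourier ξ (z + w) =
      UnitAddTorus.mFourier ξ z * UnitAddTorus.mFourier ξ w := by
  simp [mFourier_apply, Finset.sum_add_distrib, AddCircle.toCircle_add]

theorem norm_mFourier_apply (ξ : ι → ℤ) (z : UnitAddTorus ι) :
    ‖UnitAddTorus.mFourier ξ z‖ = 1 := by
  rw [mFourier_apply, Circle.norm_coe]

theorem mFourier_toTorus (ξ : ι → ℤ) (v : ι → ℝ) :
    UnitAddTorus.mFourier ξ (toTorus v) =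
      Complex.exp (2 * Real.pi * (∑ i, ξ i * v i : ℝ) * Complex.I) := by
  have : (∑ i, ξ i • toTorus v i) = ((∑ i, ξ i * v i : ℝ) : UnitAddCircle) := by
    have h := map_sum (QuotientAddGroup.mk' (AddSubgroup.zmultiples (1 : ℝ)))
      (fun i => (ξ i : ℝ) * v i) Finset.univ
    refine Eq.trans ?_ h.symm
    refine Finset.sum_congr rfl fun i _ => ?_
    simp only [toTorus]
    rw [← AddCircle.coe_zsmul, zsmul_eq_mul]
    rfl
  rw [mFourier_apply, this, AddCircle.toCircle_apply_mk]
  simp [Circle.coe_exp]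

/-- If the Fourier coefficients of `ν j` outside `S` tend to zero, then `ν j` is asymptotically
invariant under the translations by the points killed by all characters in `S`. For characters this
is clear, and trigonometric polynomials are dense. -/
theorem tendsto_integral_translate_sub {α : Type*} {l : Filter α} {ν : α → Measure (UnitAddTorus ι)}
    [∀ j, IsProbabilityMeasure (ν j)] {S : Set (ι → ℤ)}
    (hS : ∀ ξ, ξ ∉ S → Tendsto (fun j => ∫ z, UnitAddTorus.mFourier ξ z ∂ν j) l (𝓝 0))
    {w : UnitAddTorus ι} (hw : ∀ ξ ∈ S, UnitAddTorus.mFourier ξ w = 1)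
    (f : C(UnitAddTorus ι, ℂ)) :
    Tendsto (fun j => ∫ z, (f (z + w) - f z) ∂ν j) l (𝓝 0) := by
  have hint : ∀ (f : C(UnitAddTorus ι, ℂ)) j, Integrable (fun z => f (z + w) - f z) (ν j) := by
    intro f j
    have hc : Continuous fun z => f (z + w) - f z := by fun_prop
    exact hc.integrable_of_hasCompactSupport (HasCompactSupport.of_compactSpace _)
  have hspan : ∀ P ∈ Submodule.span ℂ (Set.range (UnitAddTorus.mFourier (d := ι))),
      Tendsto (fun j => ∫ z, (P (z + w) - P z) ∂ν j) l (𝓝 0) := by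
    intro P hP
    induction hP using Submodule.span_induction with
    | mem P hP =>
      obtain ⟨ξ, rfl⟩ := hP
      have : ∀ z, UnitAddTorus.mFourier ξ (z + w) - UnitAddTorus.mFourier ξ z =
          (UnitAddTorus.mFourier ξ w - 1) * UnitAddTorus.mFourier ξ z := fun z => by
        rw [mFourier_add_apply]; ring
      simp only [this, integral_const_mul]
      by_cases hξ : ξ ∈ S
      · simpa [hw ξ hξ] using tendsto_const_nhds
      · simpa using (hS ξ hξ).const_mul _
    | zero => simpa using tendsto_const_nhds
    | add P Q _ _ hP hQ =>
      refine (by simpa using hP.add hQ : Tendsto _ l (𝓝 (0 : ℂ))).congr fun j => ?_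
      rw [← integral_add (hint P j) (hint Q j)]
      exact integral_congr_ae (.of_forall fun z => by simp; ring)
    | smul a P _ hP =>
      refine (by simpa using hP.const_mul a : Tendsto _ l (𝓝 (0 : ℂ))).congr fun j => ?_
      rw [← integral_const_mul]
      exact integral_congr_ae (.of_forall fun z => by simp; ring)
  rw [Metric.tendsto_nhds]
  intro ε hε
  have hf : f ∈ closure (Submodule.span ℂ (Set.range (UnitAddTorus.mFourier (d := ι))) :
      Set C(UnitAddTorus ι, ℂ)) := by
    rw [← Submodule.topologicalClosure_coe, UnitAddTorus.span_mFourier_closure_eq_top]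
    trivial
  obtain ⟨P, hP, hfP⟩ := Metric.mem_closure_iff.1 hf (ε / 4) (by positivity)
  filter_upwards [Metric.tendsto_nhds.1 (hspan P hP) (ε / 2) (by positivity)] with j hj
  rw [dist_zero_right] at hj ⊢
  have hdiff : ∀ z, ‖f z - P z‖ ≤ ε / 4 := fun z => by
    rw [← dist_eq_norm]
    exact (ContinuousMap.dist_apply_le_dist z).trans hfP.le
  have h1 : ‖∫ z, ((f (z + w) - f z) - (P (z + w) - P z)) ∂ν j‖ ≤ ε / 2 := by
    refine (norm_integral_le_of_norm_le_const (C := ε / 2) (.of_forall fun z => ?_)).trans ?_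
    · calc ‖(f (z + w) - f z) - (P (z + w) - P z)‖
          = ‖(f (z + w) - P (z + w)) - (f z - P z)‖ := by congr 1; ring
        _ ≤ ε / 4 + ε / 4 := (norm_sub_le _ _).trans (add_le_add (hdiff _) (hdiff _))
        _ = ε / 2 := by ring
    · simp
  rw [integral_sub (hint f j) (hint P j)] at h1
  calc _ = ‖(∫ z, (f (z + w) - f z) ∂ν j - ∫ z, (P (z + w) - P z) ∂ν j)
        + ∫ z, (P (z + w) - P z) ∂ν j‖ := by congr 1; ring
    _ < ε / 2 + ε / 2 := (norm_add_le _ _).trans_lt (add_lt_add_of_le_of_lt h1 hj)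
    _ = ε := by ring

/-- Asymptotically invariant measures charge a whole coset: there is `c` such that no neighbourhood
of a point of `c + S^⊥` has measure tending to zero. Otherwise each `c` has a translate with a
neighbourhood that loses its mass; by asymptotic invariance so does a neighbourhood of `c`, and
finitely many of these cover the torus. -/
theorem exists_translate_not_tendsto_zero {α : Type*} {l : Filter α} [l.NeBot]
    {ν : α → Measure (UnitAddTorus ι)}
    [∀ j, IsProbabilityMeasure (ν j)] {S : Set (ι → ℤ)}
    (hS : ∀ ξ, ξ ∉ S → Tendsto (fun j => ∫ z, UnitAddTorus.mFourier ξ z ∂ν j) l (𝓝 0)) :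
    ∃ c : UnitAddTorus ι, ∀ w, (∀ ξ ∈ S, UnitAddTorus.mFourier ξ w = 1) →
      ∀ N ∈ 𝓝 (c + w), ¬ Tendsto (fun j => (ν j).real N) l (𝓝 0) := by
  by_contra! hcon
  have huniv : Tendsto (fun j => (ν j).real Set.univ) l (𝓝 0) := by
    refine isCompact_univ.induction_on (p := fun s => Tendsto (fun j => (ν j).real s) l (𝓝 0))
      (by simp) ?_ ?_ ?_
    · exact fun s t hst ht => squeeze_zero (fun _ => measureReal_nonneg)
        (fun j => measureReal_mono hst) ht
    · exact fun s t hs ht => squeeze_zero (fun _ => measureReal_nonneg)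
        (fun j => measureReal_union_le s t) (by simpa using hs.add ht)
    · intro c _
      obtain ⟨w, hw, N, hN, hlim⟩ := hcon c
      obtain ⟨ε, hε, hball⟩ := Metric.mem_nhds_iff.1 hN
      -- a bump function supported in the ball of radius `ε` around `c + w`
      let b : UnitAddTorus ι → ℝ := fun z => max 0 (1 - dist z (c + w) / ε)
      have hbc : Continuous b := by fun_prop
      have hb0 : ∀ z, 0 ≤ b z := fun z => le_max_left _ _
      have hb1 : ∀ z, b z ≤ 1 := fun z => max_le zero_le_one (by
        have : 0 ≤ dist z (c + w) / ε := by positivity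
        linarith)
      have hbN : ∀ z, b z ≤ (Metric.ball (c + w) ε).indicator 1 z := by
        intro z
        by_cases hz : z ∈ Metric.ball (c + w) ε
        · simpa [Set.indicator_of_mem hz] using hb1 z
        · rw [Set.indicator_of_notMem hz]
          have : 1 ≤ dist z (c + w) / ε := by
            rw [le_div_iff₀ hε]; simpa using hz
          exact max_le le_rfl (by linarith)
      have hint : ∀ (g : UnitAddTorus ι → ℝ) (_ : Continuous g) j, Integrable g (ν j) :=
        fun g hg j => hg.integrable_of_hasCompactSupport (HasCompactSupport.of_compactSpace _)
      have hb : Tendsto (fun j => ∫ z, b z ∂ν j) l (𝓝 0) := by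
        refine squeeze_zero (fun j => integral_nonneg hb0) (fun j => ?_) hlim
        calc ∫ z, b z ∂ν j ≤ ∫ z, (Metric.ball (c + w) ε).indicator 1 z ∂ν j :=
              integral_mono (hint b hbc j)
                ((integrable_const (1 : ℝ)).indicator Metric.isOpen_ball.measurableSet) hbN
          _ = (ν j).real (Metric.ball (c + w) ε) :=
              integral_indicator_one Metric.isOpen_ball.measurableSet
          _ ≤ (ν j).real N := measureReal_mono hball
      have hbw : Tendsto (fun j => ∫ z, b (z + w) ∂ν j) l (𝓝 0) := by
        have h1 := tendsto_integral_translate_sub hS hw ⟨fun z => (b z : ℂ), by fun_prop⟩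
        have h2 : Tendsto (fun j => ∫ z, (b (z + w) - b z) ∂ν j) l (𝓝 0) := by
          have h3 := (Complex.continuous_re.tendsto 0).comp h1
          refine h3.congr fun j => ?_
          simp only [ContinuousMap.coe_mk, Function.comp_apply, ← Complex.ofReal_sub]
          rw [integral_complex_ofReal, Complex.ofReal_re]
        refine (by simpa using h2.add hb : Tendsto _ l (𝓝 (0 : ℝ))).congr fun j => ?_
        rw [integral_sub (hint _ (by fun_prop) j) (hint _ hbc j)]
        ring
      have hO : IsOpen {z | 1 / 2 < b (z + w)} := isOpen_lt continuous_const (by fun_prop)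
      refine ⟨{z | 1 / 2 < b (z + w)}, mem_nhdsWithin_of_mem_nhds (hO.mem_nhds ?_), ?_⟩
      · simp only [Set.mem_ofPred_eq, b, dist_self]
        norm_num
      · refine squeeze_zero (fun _ => measureReal_nonneg) (fun j => ?_)
          (by simpa using hbw.const_mul 2)
        have : ∀ z, ({z | 1 / 2 < b (z + w)} : Set (UnitAddTorus ι)).indicator
            (1 : UnitAddTorus ι → ℝ) z ≤ 2 * b (z + w) := by
          intro z
          by_cases hz : z ∈ {z | 1 / 2 < b (z + w)}
          · rw [Set.indicator_of_mem hz]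
            have : 1 / 2 < b (z + w) := hz
            simp only [Pi.one_apply]; linarith
          · rw [Set.indicator_of_notMem hz]
            linarith [hb0 (z + w)]
        rw [← integral_const_mul, ← integral_indicator_one hO.measurableSet]
        exact integral_mono ((integrable_const (1 : ℝ)).indicator hO.measurableSet)
          (hint _ (by fun_prop) j) this
  simp at huniv

end Torus

/-! ### Subspaces given by integer equations -/

section IntegerVectors

variable {ι : Type*}

/-- An integer vector, seen as a real vector. -/
def intVec (p : ι → ℤ) : ι → ℝ := fun i => (p i : ℝ)

theorem intVec_eq_zero {p : ι → ℤ} : intVec p = 0 ↔ p = 0 := by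
  simp [intVec, funext_iff]

variable [Fintype ι]

/-- The real subspace orthogonal to a set of integer vectors. -/
def orthogonal (S : Set (ι → ℤ)) : Submodule ℝ (ι → ℝ) where
  carrier := {w | ∀ ξ ∈ S, intVec ξ ⬝ᵥ w = 0}
  add_mem' hv hw ξ hξ := by rw [dotProduct_add, hv ξ hξ, hw ξ hξ, add_zero]
  zero_mem' ξ _ := dotProduct_zero _
  smul_mem' a w hw ξ hξ := by rw [dotProduct_smul, hw ξ hξ, smul_zero]

/-- A subspace cut out by integer equations is spanned by integer vectors: expand the coordinates
of a real solution in a Hamel basis of `ℝ` over `ℚ`; the coefficients form rational solutions. -/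
theorem orthogonal_le_span_int (S : Set (ι → ℤ)) :
    orthogonal S ≤ Submodule.span ℝ {v | v ∈ orthogonal S ∧ ∃ p, intVec p = v} := by
  intro w hw
  let B := Module.Basis.ofVectorSpace ℚ ℝ
  -- rational solutions are multiples of integer solutions
  have hrat : ∀ q : ι → ℚ, (fun i => (q i : ℝ)) ∈ orthogonal S →
      (fun i => (q i : ℝ)) ∈ Submodule.span ℝ {v | v ∈ orthogonal S ∧ ∃ p, intVec p = v} := by
    intro q hq
    obtain ⟨N, hN⟩ := IsLocalization.exist_integer_multiples_of_finite (nonZeroDivisors ℤ) q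
    choose p hp using hN
    have hN0 : ((N : ℤ) : ℝ) ≠ 0 := Int.cast_ne_zero.2 (nonZeroDivisors.coe_ne_zero N)
    have hpq : intVec p = ((N : ℤ) : ℝ) • fun i => (q i : ℝ) := by
      funext i
      have := congrArg (fun r : ℚ => (r : ℝ)) (hp i)
      simpa [intVec] using this
    have hmem := Submodule.subset_span (R := ℝ)
      (show intVec p ∈ {v | v ∈ orthogonal S ∧ ∃ p, intVec p = v} from
        ⟨hpq ▸ Submodule.smul_mem _ _ hq, p, rfl⟩)
    have := Submodule.smul_mem _ (((N : ℤ) : ℝ)⁻¹) hmem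
    rwa [hpq, inv_smul_smul₀ hN0] at this
  classical
  let F : Finset _ := Finset.univ.biUnion fun i => (B.repr (w i)).support
  have hw_eq : w = ∑ k ∈ F, B k • fun i => ((B.repr (w i) k : ℚ) : ℝ) := by
    funext i
    have h1 : w i = ∑ k ∈ F, B.repr (w i) k • B k := by
      conv_lhs => rw [← B.linearCombination_repr (w i), Finsupp.linearCombination_apply]
      refine Finsupp.sum_of_support_subset _ ?_ _ (by simp)
      exact Finset.subset_biUnion_of_mem (fun i => (B.repr (w i)).support) (Finset.mem_univ i)
    conv_lhs => rw [h1]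
    simp [Finset.sum_apply, Rat.smul_def, mul_comm]
  rw [hw_eq]
  refine Submodule.sum_mem _ fun k _ => Submodule.smul_mem _ _ (hrat _ fun ξ hξ => ?_)
  have h2 := congrArg (fun r => B.repr r k) (hw ξ hξ)
  have h3 : intVec ξ ⬝ᵥ w = ∑ i, ξ i • w i := by simp [dotProduct, intVec]
  simp only [h3, map_sum, map_zsmul, map_zero, Finsupp.coe_finsetSum, Finset.sum_apply,
    Finsupp.coe_zero, Pi.zero_apply, Finsupp.smul_apply] at h2
  have h4 : ((∑ i, ξ i • B.repr (w i) k : ℚ) : ℝ) = 0 := by rw [h2]; simp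
  simpa [dotProduct, intVec] using h4

/-- A rational subspace given by integer equations contains as many independent integer vectors as
its real dimension allows. -/
theorem exists_linearIndependent_int_of_le_finrank {S : Set (ι → ℤ)} {e : ℕ}
    (he : e ≤ Module.finrank ℝ (orthogonal S)) :
    ∃ b : Fin e → ι → ℤ, LinearIndependent ℝ (fun i => intVec (b i)) ∧
      ∀ i, intVec (b i) ∈ orthogonal S := by
  obtain ⟨t, htS, hspan, hli⟩ :=
    exists_linearIndependent ℝ {v | v ∈ orthogonal S ∧ ∃ p, intVec p = v}
  have hspan' : Submodule.span ℝ t = orthogonal S := by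
    rw [hspan]
    exact le_antisymm (Submodule.span_le.2 fun v hv => hv.1) (orthogonal_le_span_int S)
  have : Finite t := hli.finite
  have : Fintype t := Fintype.ofFinite t
  have hcard : Fintype.card t = Module.finrank ℝ (orthogonal S) := by
    rw [← hspan', finrank_span_set_eq_card hli, Set.toFinset_card]
  obtain ⟨f⟩ : Nonempty (Fin e ↪ t) :=
    Function.Embedding.nonempty_of_card_le (by rw [hcard]; simpa using he)
  choose p hp using fun i => (htS (f i).2).2
  have hli' := hli.comp f f.injective
  exact ⟨p, by simp only [hp]; exact hli', fun i => hp i ▸ (htS (f i).2).1⟩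

end IntegerVectors

/-! ### Torus endomorphisms and averages of orthogonal characters -/

section Averages

variable {ι : Type*} [Fintype ι]

/-- The endomorphism of the torus `ℝ^ι / ℤ^ι` induced by an integer matrix. -/
def torusMap (M : Matrix ι ι ℤ) (z : UnitAddTorus ι) : UnitAddTorus ι := fun i => ∑ j, M i j • z j

theorem torusMap_toTorus (M : Matrix ι ι ℤ) (v : ι → ℝ) :
    torusMap M (toTorus v) = toTorus (M.map (Int.cast : ℤ → ℝ) *ᵥ v) := by
  funext i
  have h := map_sum (QuotientAddGroup.mk' (AddSubgroup.zmultiples (1 : ℝ)))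
    (fun j => (M i j : ℝ) * v j) Finset.univ
  refine Eq.trans ?_ h.symm
  refine Finset.sum_congr rfl fun j _ => ?_
  simp only [toTorus]
  rw [← AddCircle.coe_zsmul, zsmul_eq_mul]
  rfl

theorem continuous_torusMap (M : Matrix ι ι ℤ) : Continuous (torusMap M) := by
  unfold torusMap
  fun_prop

theorem mFourier_torusMap (ξ : ι → ℤ) (M : Matrix ι ι ℤ) (z : UnitAddTorus ι) :
    UnitAddTorus.mFourier ξ (torusMap M z) = UnitAddTorus.mFourier (ξ ᵥ* M) z := by
  rw [mFourier_apply, mFourier_apply]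
  congr 2
  simp only [torusMap, Matrix.vecMul, dotProduct, Finset.smul_sum, Finset.sum_smul, smul_smul]
  exact Finset.sum_comm

theorem mFourier_toTorus_eq_one {ξ : ι → ℤ} {v : ι → ℝ} (h : intVec ξ ⬝ᵥ v = 0) :
    UnitAddTorus.mFourier ξ (toTorus v) = 1 := by
  rw [mFourier_toTorus, show ∑ i, (ξ i : ℝ) * v i = 0 from h]
  simp

/-- A module of integer vectors is finitely generated, so conditions that hold eventually for each
of its elements hold eventually for all of them at once. -/
theorem eventually_le_of_forall_eventually {α : Type*} {l : Filter α}
    (S : Submodule ℤ (ι → ℤ)) (Q : α → Submodule ℤ (ι → ℤ))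
    (h : ∀ ξ ∈ S, ∀ᶠ j in l, ξ ∈ Q j) : ∀ᶠ j in l, S ≤ Q j := by
  obtain ⟨t, rfl⟩ := IsNoetherian.noetherian S
  have : ∀ᶠ j in l, ∀ ξ ∈ t, ξ ∈ Q j :=
    (eventually_all_finset t).2 fun ξ hξ => h ξ (Submodule.subset_span hξ)
  exact this.mono fun j hj => Submodule.span_le.2 hj

/-- A measure invariant under the one-parameter group of `u` has vanishing Fourier coefficient at
each character that is nontrivial on this group. -/
theorem integral_mFourier_eq_zero {μ : Measure (UnitAddTorus ι)}
    {u : ι → ℤ} (hinv : ∀ s : ℝ, μ.map (· + toTorus (s • intVec u)) = μ)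
    {η : ι → ℤ} (hη : η ⬝ᵥ u ≠ 0) : ∫ z, UnitAddTorus.mFourier η z ∂μ = 0 := by
  have hη' : ((η ⬝ᵥ u : ℤ) : ℝ) ≠ 0 := Int.cast_ne_zero.2 hη
  -- translation by `s u` with `s = 1 / (2 ⟨η, u⟩)` changes the sign of the character
  set s : ℝ := 1 / (2 * (η ⬝ᵥ u : ℤ)) with hs
  have hsign : UnitAddTorus.mFourier η (toTorus (s • intVec u)) = -1 := by
    have : (∑ i, (η i : ℝ) * (s • intVec u) i) = 1 / 2 := by
      have h1 : (∑ i, (η i : ℝ) * (s • intVec u) i) = s * (η ⬝ᵥ u : ℤ) := by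
        simp only [intVec, Pi.smul_apply, smul_eq_mul, dotProduct, Int.cast_sum, Int.cast_mul,
          Finset.mul_sum]
        exact Finset.sum_congr rfl fun i _ => by ring
      rw [h1, hs]
      field_simp
    rw [mFourier_toTorus, this, ← Complex.exp_pi_mul_I]
    congr 1
    push_cast
    ring
  have h1 : ∫ z, UnitAddTorus.mFourier η z ∂μ = -∫ z, UnitAddTorus.mFourier η z ∂μ := by
    conv_lhs => rw [← hinv s]
    rw [integral_map (by fun_prop) (UnitAddTorus.mFourier η).continuous.aestronglyMeasurable,
      ← integral_neg]
    simp only [mFourier_add_apply, hsign]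
    simp
  exact self_eq_neg.1 h1

/-- A strong law of large numbers along squares: the averages of the first `j ^ 2` terms of a
bounded and eventually orthogonal sequence tend to zero almost everywhere, because their second
moments are of size `1 / j ^ 2`. -/
theorem ae_tendsto_average_zero {Ω : Type*} [MeasurableSpace Ω] {μ : Measure Ω}
    [IsProbabilityMeasure μ] {f : ℕ → Ω → ℂ} (hf : ∀ k, Measurable (f k))
    (hb : ∀ k z, ‖f k z‖ ≤ 1) (K : ℕ)
    (horth : ∀ k l, K ≤ k → K ≤ l → k ≠ l → ∫ z, f k z * starRingEnd ℂ (f l z) ∂μ = 0) :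
    ∀ᵐ z ∂μ, Tendsto (fun j : ℕ => ((j : ℂ) ^ 2)⁻¹ * ∑ k ∈ Finset.range (j ^ 2), f k z)
      atTop (𝓝 0) := by
  -- discard the first `K` terms
  let g : ℕ → Ω → ℂ := fun k z => if K ≤ k then f k z else 0
  have hg : ∀ k, Measurable (g k) := fun k => by
    by_cases h : K ≤ k <;> simp only [g, h, if_true, if_false] <;> fun_prop
  have hgb : ∀ k z, ‖g k z‖ ≤ 1 := fun k z => by
    by_cases h : K ≤ k <;> simp [g, h, hb]
  have hgi : ∀ k l, Integrable (fun z => g k z * starRingEnd ℂ (g l z)) μ := fun k l =>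
    Integrable.of_bound (by
      have := hg k; have := hg l
      have h2 : Measurable fun z => starRingEnd ℂ (g l z) :=
        Complex.continuous_conj.measurable.comp (hg l)
      fun_prop) 1 (.of_forall fun z => by
        rw [norm_mul, RCLike.norm_conj]
        exact mul_le_one₀ (hgb k z) (norm_nonneg _) (hgb l z))
  have hgo : ∀ k l, k ≠ l → ∫ z, g k z * starRingEnd ℂ (g l z) ∂μ = 0 := fun k l hkl => by
    by_cases hk : K ≤ k <;> by_cases hl : K ≤ l <;> simp [g, hk, hl]
    exact horth k l hk hl hkl
  have hsq : ∀ N : ℕ, ∫ z, ‖∑ k ∈ Finset.range N, g k z‖ ^ 2 ∂μ ≤ N := fun N => by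
    have h1 : ((∫ z, ‖∑ k ∈ Finset.range N, g k z‖ ^ 2 ∂μ : ℝ) : ℂ) =
        ∑ k ∈ Finset.range N, ∫ z, g k z * starRingEnd ℂ (g k z) ∂μ := by
      rw [← integral_complex_ofReal]
      have : ∀ z, ((‖∑ k ∈ Finset.range N, g k z‖ ^ 2 : ℝ) : ℂ) =
          ∑ k ∈ Finset.range N, ∑ l ∈ Finset.range N, g k z * starRingEnd ℂ (g l z) := fun z => by
        rw [← Finset.sum_mul_sum, ← map_sum, Complex.mul_conj, Complex.normSq_eq_norm_sq]
      simp only [this]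
      rw [integral_finsetSum _ fun k _ => integrable_finsetSum _ fun l _ => hgi k l]
      refine Finset.sum_congr rfl fun k hk => ?_
      rw [integral_finsetSum _ fun l _ => hgi k l]
      exact Finset.sum_eq_single_of_mem k hk fun l _ hl => hgo k l hl.symm
    have h2 : ‖((∫ z, ‖∑ k ∈ Finset.range N, g k z‖ ^ 2 ∂μ : ℝ) : ℂ)‖ ≤ N := by
      rw [h1]
      refine (norm_sum_le _ _).trans ?_
      calc _ ≤ ∑ k ∈ Finset.range N, (1 : ℝ) := Finset.sum_le_sum fun k _ => by
            refine (norm_integral_le_of_norm_le_const (C := 1) (.of_forall fun z => ?_)).trans ?_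
            · rw [norm_mul, RCLike.norm_conj]
              exact mul_le_one₀ (hgb k z) (norm_nonneg _) (hgb k z)
            · simp
        _ = N := by simp
    rw [Complex.norm_real] at h2
    exact (le_abs_self _).trans h2
  have hmeas : ∀ N, Measurable fun z => ∑ k ∈ Finset.range N, g k z := fun N =>
    Finset.measurable_sum _ fun k _ => hg k
  -- the second moments of the averages along squares are summable
  have hlint : ∀ j : ℕ, ∫⁻ z, ENNReal.ofReal
      (‖((j : ℂ) ^ 2)⁻¹ * ∑ k ∈ Finset.range (j ^ 2), g k z‖ ^ 2) ∂μ ≤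
        ENNReal.ofReal (1 / (j : ℝ) ^ 2) := fun j => by
    rw [← ofReal_integral_eq_lintegral_ofReal]
    · refine ENNReal.ofReal_le_ofReal ?_
      simp only [norm_mul, mul_pow, integral_const_mul]
      rcases Nat.eq_zero_or_pos j with rfl | hj
      · simp
      have hj' : (0 : ℝ) < j := by exact_mod_cast hj
      calc _ ≤ ‖((j : ℂ) ^ 2)⁻¹‖ ^ 2 * ((j ^ 2 : ℕ) : ℝ) :=
            mul_le_mul_of_nonneg_left (hsq _) (by positivity)
        _ = 1 / (j : ℝ) ^ 2 := by
          simp only [norm_inv, norm_pow, Complex.norm_natCast]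
          push_cast
          field_simp
    · refine Integrable.of_bound (by have := hmeas (j ^ 2); fun_prop)
        ((‖((j : ℂ) ^ 2)⁻¹‖ * j ^ 2) ^ 2) (.of_forall fun z => ?_)
      rw [norm_pow, norm_norm, norm_mul]
      gcongr
      refine (norm_sum_le _ _).trans ((Finset.sum_le_sum fun k _ => hgb k z).trans ?_)
      simp
    · exact .of_forall fun z => by positivity
  have hsum : ∫⁻ z, ∑' j : ℕ, ENNReal.ofReal
      (‖((j : ℂ) ^ 2)⁻¹ * ∑ k ∈ Finset.range (j ^ 2), g k z‖ ^ 2) ∂μ ≠ ⊤ := by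
    rw [lintegral_tsum fun j => by have := hmeas (j ^ 2); fun_prop]
    refine ne_top_of_le_ne_top ?_ (ENNReal.tsum_le_tsum hlint)
    rw [← ENNReal.ofReal_tsum_of_nonneg (fun j => by positivity)
      (Real.summable_one_div_nat_pow.2 one_lt_two)]
    exact ENNReal.ofReal_ne_top
  have hae := ae_lt_top' (by
    refine AEMeasurable.tsum fun j => ?_
    have := hmeas (j ^ 2)
    fun_prop) hsum
  filter_upwards [hae] with z hz
  have h1 : Tendsto (fun j : ℕ => ‖((j : ℂ) ^ 2)⁻¹ * ∑ k ∈ Finset.range (j ^ 2), g k z‖ ^ 2)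
      atTop (𝓝 0) := by
    have h2 := ENNReal.tendsto_atTop_zero_of_tsum_ne_top hz.ne
    have h3 := (ENNReal.tendsto_toReal ENNReal.zero_ne_top).comp h2
    rw [ENNReal.toReal_zero] at h3
    refine h3.congr fun j => ?_
    exact ENNReal.toReal_ofReal (by positivity)
  have h4 : Tendsto (fun j : ℕ => ((j : ℂ) ^ 2)⁻¹ * ∑ k ∈ Finset.range (j ^ 2), g k z)
      atTop (𝓝 0) := by
    rw [tendsto_zero_iff_norm_tendsto_zero]
    have := (Real.continuous_sqrt.tendsto 0).comp h1
    rw [Real.sqrt_zero] at this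
    refine this.congr fun j => ?_
    exact Real.sqrt_sq (norm_nonneg _)
  have h5 : Tendsto (fun j : ℕ => ((j : ℂ) ^ 2)⁻¹ * ∑ k ∈ Finset.range (j ^ 2), (f k z - g k z))
      atTop (𝓝 0) := by
    have hC : ∀ N, ‖∑ k ∈ Finset.range N, (f k z - g k z)‖ ≤ K := fun N => by
      have h6 : ∀ k, ‖f k z - g k z‖ ≤ if k ∈ Finset.range K then 1 else 0 := fun k => by
        by_cases hk : K ≤ k
        · simp only [g, hk, if_true, sub_self, norm_zero]
          split_ifs <;> norm_num
        · simp [g, hk, hb, not_le.1 hk]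
      refine (norm_sum_le _ _).trans ((Finset.sum_le_sum fun k _ => h6 k).trans ?_)
      rw [← Finset.sum_filter, Finset.sum_const, nsmul_eq_mul, mul_one]
      have : (Finset.filter (fun k => k ∈ Finset.range K) (Finset.range N)) ⊆ Finset.range K :=
        fun k hk => (Finset.mem_filter.1 hk).2
      exact_mod_cast (Finset.card_le_card this).trans (by simp)
    refine squeeze_zero_norm (a := fun j : ℕ => ((j : ℝ) ^ 2)⁻¹ * K) (fun j => ?_) ?_
    · rw [norm_mul]
      simp only [norm_inv, norm_pow, Complex.norm_natCast]
      gcongr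
      exact hC _
    · have : Tendsto (fun j : ℕ => ((j : ℝ) ^ 2)⁻¹) atTop (𝓝 0) :=
        tendsto_inv_atTop_zero.comp ((tendsto_pow_atTop two_ne_zero).comp
          tendsto_natCast_atTop_atTop)
      simpa using this.mul_const (K : ℝ)
  have h6 := h4.add h5
  rw [add_zero] at h6
  refine h6.congr fun j => ?_
  rw [Finset.sum_sub_distrib]
  ring

end Averages

/-! ### Accumulation points of almost every orbit -/

section Empirical

variable {ι : Type*} [Fintype ι]

/-- The uniform probability measure on the first `N + 1` terms of a sequence. -/
def empiricalMeasure {Ω : Type*} [MeasurableSpace Ω] (x : ℕ → Ω) (N : ℕ) : Measure Ω :=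
  ((N + 1 : ℕ) : ENNReal)⁻¹ • ∑ k ∈ Finset.range (N + 1), Measure.dirac (x k)

instance {Ω : Type*} [MeasurableSpace Ω] (x : ℕ → Ω) (N : ℕ) :
    IsProbabilityMeasure (empiricalMeasure x N) := ⟨by
  simp only [empiricalMeasure, Measure.smul_apply, Measure.finsetSum_apply, measure_univ,
    Finset.sum_const, Finset.card_range, nsmul_eq_mul, mul_one, smul_eq_mul]
  exact ENNReal.inv_mul_cancel (by simp) (ENNReal.natCast_ne_top _)⟩

theorem integral_empiricalMeasure {Ω : Type*} [MeasurableSpace Ω] {f : Ω → ℂ} (hf : Measurable f)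
    (x : ℕ → Ω) (N : ℕ) :
    ∫ z, f z ∂empiricalMeasure x N = ((N + 1 : ℕ) : ℂ)⁻¹ * ∑ k ∈ Finset.range (N + 1), f (x k) := by
  rw [empiricalMeasure, integral_smul_measure, integral_finsetSum_measure,
    ENNReal.toReal_inv, ENNReal.toReal_natCast]
  · simp [integral_dirac' f _ hf.stronglyMeasurable]
  · intro k _
    refine integrable_dirac' hf.stronglyMeasurable ?_
    simp

theorem tendsto_empiricalMeasure_zero {Ω : Type*} [MeasurableSpace Ω] {x : ℕ → Ω} {O : Set Ω}
    (hO : MeasurableSet O) (h : ∀ᶠ k in atTop, x k ∉ O) :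
    Tendsto (fun N => (empiricalMeasure x N).real O) atTop (𝓝 0) := by
  obtain ⟨K, hK⟩ := eventually_atTop.1 h
  have hbound : ∀ N, (empiricalMeasure x N).real O ≤ K * (1 / ((N : ℝ) + 1)) := fun N => by
    classical
    have h1 : (∑ k ∈ Finset.range (N + 1), Measure.dirac (x k)) O ≤ K := by
      simp only [Measure.finsetSum_apply, Measure.dirac_apply' _ hO]
      calc ∑ k ∈ Finset.range (N + 1), O.indicator (1 : Ω → ENNReal) (x k)
          ≤ ∑ k ∈ Finset.range (N + 1), if k ∈ Finset.range K then 1 else 0 := by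
            refine Finset.sum_le_sum fun k _ => ?_
            by_cases hk : K ≤ k
            · simp [Set.indicator_of_notMem (hK k hk)]
            · simp only [Finset.mem_range, not_le.1 hk, if_true]
              exact Set.indicator_le_self' (fun _ _ => zero_le) _
        _ ≤ K := by
          rw [← Finset.sum_filter, Finset.sum_const, nsmul_eq_mul, mul_one]
          have : (Finset.filter (fun k => k ∈ Finset.range K) (Finset.range (N + 1))) ⊆
              Finset.range K := fun k hk => (Finset.mem_filter.1 hk).2
          exact_mod_cast (Finset.card_le_card this).trans (by simp)
    rw [Measure.real, empiricalMeasure, Measure.smul_apply, smul_eq_mul, ENNReal.toReal_mul,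
      mul_comm]
    gcongr
    · exact ENNReal.toReal_le_of_le_ofReal (by positivity) (by simpa using h1)
    · rw [ENNReal.toReal_inv, ENNReal.toReal_natCast]
      simp
  refine squeeze_zero (fun _ => measureReal_nonneg) hbound ?_
  simpa using tendsto_one_div_add_atTop_nhds_zero_nat.const_mul (K : ℝ)

theorem dotProduct_intVec (ξ p : ι → ℤ) : intVec ξ ⬝ᵥ intVec p = ((ξ ⬝ᵥ p : ℤ) : ℝ) := by
  simp [intVec, dotProduct]

/-- Let `μ` be invariant under the one-parameter group of the integer vector `u`, and let `γ k u`
leave every finite set. Then for almost every `z` the sequence `γ k z` accumulates at every point of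
a translate of a fixed one-dimensional subtorus. Its direction `b` is orthogonal to the module `S`
of the characters `ξ` for which `⟨ξ, γ k u⟩` is constant along an ultrafilter; all other characters
average to zero along a subsequence, which makes the empirical measures of almost every orbit
asymptotically invariant. -/
theorem exists_ae_forall_mapClusterPt {μ : Measure (UnitAddTorus ι)} [IsProbabilityMeasure μ]
    {u : ι → ℤ} (hinv : ∀ s : ℝ, μ.map (· + toTorus (s • intVec u)) = μ)
    {γ : ℕ → Matrix ι ι ℤ} (hγ : ∀ p, ∀ᶠ k in atTop, γ k *ᵥ u ≠ p) :
    ∃ b : ι → ℤ, b ≠ 0 ∧ ∀ᵐ z ∂μ, ∃ c : ι → ℝ, ∀ s : ℝ,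
      MapClusterPt (toTorus (c + s • intVec b)) atTop (fun k => torusMap (γ k) z) := by
  let H : Filter ℕ := Filter.hyperfilter ℕ
  have hH : H ≤ atTop := Nat.hyperfilter_le_atTop
  -- the characters whose frequencies along `u` stay constant
  let S : Submodule ℤ (ι → ℤ) :=
    { carrier := {ξ | ∃ a : ℤ, ∀ᶠ k in H, ξ ⬝ᵥ (γ k *ᵥ u) = a}
      add_mem' := by
        rintro ξ η ⟨a, ha⟩ ⟨a', ha'⟩
        exact ⟨a + a', by filter_upwards [ha, ha'] with k h h'; rw [add_dotProduct, h, h']⟩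
      zero_mem' := ⟨0, .of_forall fun k => zero_dotProduct _⟩
      smul_mem' := by
        rintro n ξ ⟨a, ha⟩
        exact ⟨n • a, by filter_upwards [ha] with k h; rw [smul_dotProduct, h]⟩ }
  have hpos : 1 ≤ Module.finrank ℝ (orthogonal (S : Set (ι → ℤ))) := by
    by_contra! hlt
    have hbot : orthogonal (S : Set (ι → ℤ)) = ⊥ :=
      Submodule.finrank_eq_zero.1 (by omega)
    -- for most `k, l` the vector `γ k u - γ l u` is orthogonal to `S`, hence zero
    have hQ : ∀ᶠ k in H, ∀ᶠ l in H, ∀ ξ ∈ S, ξ ⬝ᵥ (γ k *ᵥ u - γ l *ᵥ u) = 0 := by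
      let Q : ℕ × ℕ → Submodule ℤ (ι → ℤ) := fun p =>
        { carrier := {ξ | ξ ⬝ᵥ (γ p.1 *ᵥ u - γ p.2 *ᵥ u) = 0}
          add_mem' := fun {ξ η} h h' => by
            simp only [Set.mem_ofPred_eq] at h h' ⊢
            rw [add_dotProduct, h, h', add_zero]
          zero_mem' := zero_dotProduct _
          smul_mem' := fun n ξ h => by
            simp only [Set.mem_ofPred_eq] at h ⊢
            rw [smul_dotProduct, h, smul_zero] }
      have h1 : ∀ᶠ p in H ×ˢ H, S ≤ Q p :=
        eventually_le_of_forall_eventually S Q fun ξ ⟨a, ha⟩ => by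
          filter_upwards [ha.prod_inl H, ha.prod_inr H] with p h h'
          change ξ ⬝ᵥ (γ p.1 *ᵥ u - γ p.2 *ᵥ u) = 0
          rw [dotProduct_sub, h, h', sub_self]
      exact h1.curry.mono fun k hk => hk.mono fun l hl ξ hξ => hl hξ
    obtain ⟨k, hk⟩ := hQ.exists
    obtain ⟨l, hl, hne⟩ := (hk.and (hH (hγ (γ k *ᵥ u)))).exists
    have hmem : intVec (γ k *ᵥ u - γ l *ᵥ u) ∈ orthogonal (S : Set (ι → ℤ)) := fun ξ hξ => by
      rw [dotProduct_intVec, hl ξ hξ, Int.cast_zero]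
    rw [hbot, Submodule.mem_bot, intVec_eq_zero, sub_eq_zero] at hmem
    exact hne hmem.symm
  obtain ⟨b, hbli, hbS⟩ := exists_linearIndependent_int_of_le_finrank hpos
  refine ⟨b 0, fun h => hbli.ne_zero 0 (intVec_eq_zero.2 h), ?_⟩
  -- a subsequence along which all other characters have eventually distinct frequencies
  obtain ⟨f, hf⟩ := exists_surjective_nat (ι → ℤ)
  have hdist : ∀ ξ, ξ ∉ S → ∀ a : ℤ, ∀ᶠ k in H, ξ ⬝ᵥ (γ k *ᵥ u) ≠ a := fun ξ hξ a =>
    Ultrafilter.eventually_not.2 fun h => hξ ⟨a, h⟩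
  obtain ⟨φ, -, hφ⟩ := exists_seq_of_forall_finset_exists (fun _ : ℕ => True)
    (fun k l => k < l ∧ ∀ i ≤ k, f i ∉ S → f i ⬝ᵥ (γ k *ᵥ u) ≠ f i ⬝ᵥ (γ l *ᵥ u)) (by
      intro s _
      have h1 : ∀ᶠ l in H, ∀ k ∈ s,
          k < l ∧ ∀ i ≤ k, f i ∉ S → f i ⬝ᵥ (γ k *ᵥ u) ≠ f i ⬝ᵥ (γ l *ᵥ u) := by
        refine (eventually_all_finset s).2 fun k _ => Eventually.and (hH (eventually_gt_atTop k)) ?_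
        refine (Set.finite_Iic k).eventually_all.2 fun i _ => ?_
        by_cases hi : f i ∈ S
        · exact .of_forall fun _ h => absurd hi h
        · exact (hdist _ hi _).mono fun l hl _ => hl.symm
      obtain ⟨l, hl⟩ := h1.exists
      exact ⟨l, trivial, hl⟩)
  have hφm : StrictMono φ := fun m n h => (hφ m n h).1
  have hξ : ∀ ξ, ξ ∉ S → ∀ᵐ z ∂μ, Tendsto (fun j : ℕ => ((j : ℂ) ^ 2)⁻¹ *
      ∑ k ∈ Finset.range (j ^ 2), UnitAddTorus.mFourier ξ (torusMap (γ (φ k)) z)) atTop (𝓝 0) := by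
    intro ξ hξS
    obtain ⟨i, rfl⟩ := hf ξ
    refine ae_tendsto_average_zero (fun k => ?_) (fun k z => (norm_mFourier_apply _ _).le) i ?_
    · exact ((UnitAddTorus.mFourier (f i)).continuous.comp (continuous_torusMap _)).measurable
    · intro k l hk hl hkl
      have hne : f i ⬝ᵥ (γ (φ k) *ᵥ u) ≠ f i ⬝ᵥ (γ (φ l) *ᵥ u) := by
        rcases lt_or_gt_of_ne hkl with h | h
        · exact (hφ k l h).2 i (hk.trans (hφm.le_apply)) hξS
        · exact ((hφ l k h).2 i (hl.trans (hφm.le_apply)) hξS).symm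
      simp only [mFourier_torusMap, ← UnitAddTorus.mFourier_neg, ← UnitAddTorus.mFourier_add]
      refine integral_mFourier_eq_zero hinv ?_
      rw [add_dotProduct, neg_dotProduct, ← Matrix.dotProduct_mulVec, ← Matrix.dotProduct_mulVec,
        ← sub_eq_add_neg]
      exact sub_ne_zero.2 hne
  have hall : ∀ᵐ z ∂μ, ∀ ξ, ξ ∉ S → Tendsto (fun j : ℕ => ((j : ℂ) ^ 2)⁻¹ *
      ∑ k ∈ Finset.range (j ^ 2), UnitAddTorus.mFourier ξ (torusMap (γ (φ k)) z)) atTop (𝓝 0) :=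
    ae_all_iff.2 fun ξ => by
      by_cases h : ξ ∈ S
      · exact .of_forall fun _ h' => absurd h h'
      · exact (hξ ξ h).mono fun z hz _ => hz
  filter_upwards [hall] with z hz
  -- `N j + 1 = (j + 1) ^ 2`, so that the empirical measures average over squares
  let N : ℕ → ℕ := fun j => j ^ 2 + 2 * j
  have hN : ∀ j, N j + 1 = (j + 1) ^ 2 := fun j => by simp only [N]; ring
  have hNtop : Tendsto N atTop atTop :=
    tendsto_atTop_mono (fun j => by simp only [N, id]; nlinarith) tendsto_id
  let x : ℕ → UnitAddTorus ι := fun k => torusMap (γ (φ k)) z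
  obtain ⟨c, hc⟩ := exists_translate_not_tendsto_zero (l := atTop)
    (ν := fun j => empiricalMeasure x (N j)) (S := S) (fun ξ hξ => by
      have h1 := (hz ξ hξ).comp (tendsto_add_atTop_nat 1)
      refine h1.congr fun j => ?_
      rw [integral_empiricalMeasure (UnitAddTorus.mFourier ξ).continuous.measurable, hN]
      simp [x])
  obtain ⟨c, rfl⟩ := isOpenQuotientMap_toTorus.surjective c
  refine ⟨c, fun s => mapClusterPt_iff_frequently.2 fun O hO => ?_⟩
  obtain ⟨O', hO'O, hO', hcO'⟩ := mem_nhds_iff.1 hO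
  by_contra hcon
  rw [not_frequently] at hcon
  refine hc (toTorus (s • intVec (b 0))) (fun ξ hξ => mFourier_toTorus_eq_one ?_) O'
    (hO'.mem_nhds hcO') ((tendsto_empiricalMeasure_zero hO'.measurableSet ?_).comp hNtop)
  · rw [dotProduct_smul, hbS 0 ξ hξ, smul_zero]
  · exact (hφm.tendsto_atTop.eventually hcon).mono fun k hk hkO => hk (hO'O hkO)

end Empirical

/-! ### Limits of translated subtori -/

section LimitCosets

variable {ι : Type*} [Fintype ι]

theorem integral_exp_intCast_eq_zero {a : ℤ} (ha : a ≠ 0) :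
    ∫ r in Set.Icc (0 : ℝ) 1, Complex.exp (2 * Real.pi * (r * a : ℝ) * Complex.I) = 0 := by
  have hc : (2 * Real.pi * a * Complex.I : ℂ) ≠ 0 := by
    have : (a : ℂ) ≠ 0 := Int.cast_ne_zero.2 ha
    simp [this, Real.pi_ne_zero]
  rw [integral_Icc_eq_integral_Ioc, ← intervalIntegral.integral_of_le zero_le_one]
  have h1 : ∀ r : ℝ, Complex.exp (2 * Real.pi * (r * a : ℝ) * Complex.I) =
      Complex.exp ((2 * Real.pi * a * Complex.I) * r) := fun r => by
    congr 1; push_cast; ring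
  simp only [h1]
  rw [integral_exp_mul_complex hc]
  have h2 : Complex.exp (2 * Real.pi * a * Complex.I * (1 : ℝ)) = 1 := by
    rw [Complex.exp_eq_one_iff]
    exact ⟨a, by push_cast; ring⟩
  rw [h2]
  simp

/-- Lebesgue measure on the unit cube, which serves to parametrize translated subtori. -/
def cubeMeasure (e : ℕ) : Measure (Fin e → ℝ) :=
  Measure.pi fun _ => volume.restrict (Set.Icc 0 1)

instance (e : ℕ) : IsProbabilityMeasure (cubeMeasure e) := by
  have : IsProbabilityMeasure (volume.restrict (Set.Icc (0 : ℝ) 1)) := ⟨by simp⟩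
  unfold cubeMeasure
  infer_instance

theorem integral_cubeMeasure_mFourier_eq_zero {e : ℕ} (c : ι → ℝ) (b : Fin e → ι → ℤ)
    {ξ : ι → ℤ} {i₀ : Fin e} (h : ξ ⬝ᵥ b i₀ ≠ 0) :
    ∫ r, UnitAddTorus.mFourier ξ (toTorus (c + ∑ i, r i • intVec (b i))) ∂cubeMeasure e = 0 := by
  have h1 : ∀ r : Fin e → ℝ,
      UnitAddTorus.mFourier ξ (toTorus (c + ∑ i, r i • intVec (b i))) =
        UnitAddTorus.mFourier ξ (toTorus c) *
          ∏ i, Complex.exp (2 * Real.pi * (r i * (ξ ⬝ᵥ b i : ℤ) : ℝ) * Complex.I) := by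
    intro r
    rw [toTorus_add, mFourier_add_apply, mFourier_toTorus ξ (∑ i, r i • intVec (b i)),
      ← Complex.exp_sum]
    congr 2
    have h2 : ∑ a, (ξ a : ℝ) * (∑ i, r i • intVec (b i)) a =
        ∑ i, r i * ((ξ ⬝ᵥ b i : ℤ) : ℝ) := by
      have : intVec ξ ⬝ᵥ (∑ i, r i • intVec (b i)) = ∑ i, r i * ((ξ ⬝ᵥ b i : ℤ) : ℝ) := by
        rw [dotProduct_sum]
        exact Finset.sum_congr rfl fun i _ => by rw [dotProduct_smul, dotProduct_intVec]; rfl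
      exact this
    rw [h2]
    push_cast
    rw [Finset.mul_sum, Finset.sum_mul]
  simp only [h1]
  rw [integral_const_mul, cubeMeasure,
    integral_fintype_prod_eq_prod (fun i (r : ℝ) =>
      Complex.exp (2 * Real.pi * (r * (ξ ⬝ᵥ b i : ℤ) : ℝ) * Complex.I)),
    Finset.prod_eq_zero (Finset.mem_univ i₀) (integral_exp_intCast_eq_zero h), mul_zero]

theorem intVec_mulVec (M : Matrix ι ι ℤ) (p : ι → ℤ) :
    intVec (M *ᵥ p) = M.map (Int.cast : ℤ → ℝ) *ᵥ intVec p := by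
  funext i
  simp [intVec, Matrix.mulVec, dotProduct]

/-- Limits of translated subtori. Let `γ j` move an `e`-dimensional rational subspace in such a way
that no filter finer than `atTop` makes its images constant. Then the images under `γ j` of a
translate of the corresponding subtorus accumulate at every point of a translate of an
`(e + 1)`-dimensional subtorus. The limit directions are orthogonal to the module `S` of characters
that are trivial on most of the images; if `S^⊥` had dimension only `e`, it would be equal to most
of the images. -/
theorem exists_larger_limit_coset {γ : ℕ → Matrix ι ι ℤ} {e : ℕ} {b : Fin e → ι → ℤ} (c : ι → ℝ)
    (hli : ∀ j, LinearIndependent ℝ fun i => intVec (γ j *ᵥ b i))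
    (hnc : ∀ l : Filter ℕ, l.NeBot → l ≤ atTop → ∀ W : Submodule ℝ (ι → ℝ),
      ¬ ∀ᶠ j in l, Submodule.span ℝ (Set.range fun i => intVec (γ j *ᵥ b i)) = W) :
    ∃ (b' : Fin (e + 1) → ι → ℤ) (c' : ι → ℝ), LinearIndependent ℝ (fun i => intVec (b' i)) ∧
      ∀ s : Fin (e + 1) → ℝ, ∀ O ∈ 𝓝 (toTorus (c' + ∑ i, s i • intVec (b' i))),
        ∃ᶠ j in atTop, ∃ r : Fin e → ℝ,
          torusMap (γ j) (toTorus (c + ∑ i, r i • intVec (b i))) ∈ O := by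
  let H : Filter ℕ := Filter.hyperfilter ℕ
  have hH : H ≤ atTop := Nat.hyperfilter_le_atTop
  let Q : ℕ → Submodule ℤ (ι → ℤ) := fun j =>
    { carrier := {ξ | ∀ i, ξ ⬝ᵥ (γ j *ᵥ b i) = 0}
      add_mem' := fun {ξ η} h h' i => by rw [add_dotProduct, h i, h' i, add_zero]
      zero_mem' := fun i => zero_dotProduct _
      smul_mem' := fun n ξ h i => by rw [smul_dotProduct, h i, smul_zero] }
  -- the characters that are trivial on most of the subtori
  let S : Submodule ℤ (ι → ℤ) :=
    { carrier := {ξ | ∀ᶠ j in H, ξ ∈ Q j}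
      add_mem' := fun h h' => by filter_upwards [h, h'] with j hj hj' using add_mem hj hj'
      zero_mem' := .of_forall fun j => zero_mem _
      smul_mem' := fun n ξ h => by
        filter_upwards [h] with j hj using Submodule.smul_mem _ _ hj }
  have hle : e + 1 ≤ Module.finrank ℝ (orthogonal (S : Set (ι → ℤ))) := by
    by_contra! hlt
    refine hnc H inferInstance hH (orthogonal (S : Set (ι → ℤ))) ?_
    filter_upwards [eventually_le_of_forall_eventually S Q fun ξ hξ => hξ] with j hj
    refine Submodule.eq_of_le_of_finrank_le (Submodule.span_le.2 ?_) ?_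
    · rintro _ ⟨i, rfl⟩ ξ hξ
      rw [dotProduct_intVec, hj hξ i, Int.cast_zero]
    · rw [finrank_span_eq_card (hli j), Fintype.card_fin]
      omega
  obtain ⟨b', hb'li, hb'S⟩ := exists_linearIndependent_int_of_le_finrank hle
  have hpt : ∀ j (r : Fin e → ℝ), torusMap (γ j) (toTorus (c + ∑ i, r i • intVec (b i))) =
      toTorus ((γ j).map (Int.cast : ℤ → ℝ) *ᵥ c + ∑ i, r i • intVec (γ j *ᵥ b i)) := by
    intro j r
    rw [torusMap_toTorus, Matrix.mulVec_add, Matrix.mulVec_sum]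
    simp only [Matrix.mulVec_smul, intVec_mulVec]
  let P : ℕ → (Fin e → ℝ) → UnitAddTorus ι :=
    fun j r => torusMap (γ j) (toTorus (c + ∑ i, r i • intVec (b i)))
  have hP : ∀ j, Continuous (P j) := fun j =>
    (continuous_torusMap _).comp (isOpenQuotientMap_toTorus.continuous.comp (by fun_prop))
  have hprob : ∀ j, IsProbabilityMeasure ((cubeMeasure e).map (P j)) := fun j =>
    Measure.isProbabilityMeasure_map (hP j).measurable.aemeasurable
  obtain ⟨c', hc'⟩ := exists_translate_not_tendsto_zero (l := H)
    (ν := fun j => (cubeMeasure e).map (P j)) (S := S) (fun ξ hξ => by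
      have h1 : ∀ᶠ j in H, ξ ∉ Q j := Ultrafilter.eventually_not.2 hξ
      refine tendsto_const_nhds.congr' (h1.mono fun j hj => ?_)
      have h2 : ∃ i, ξ ⬝ᵥ (γ j *ᵥ b i) ≠ 0 := by
        by_contra! h; exact hj h
      obtain ⟨i, hi⟩ := h2
      beta_reduce
      rw [integral_map (hP j).measurable.aemeasurable
        (UnitAddTorus.mFourier ξ).continuous.aestronglyMeasurable]
      simp only [P, hpt]
      exact (integral_cubeMeasure_mFourier_eq_zero _ (fun i => γ j *ᵥ b i) hi).symm)
  obtain ⟨c', rfl⟩ := isOpenQuotientMap_toTorus.surjective c'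
  refine ⟨b', c', hb'li, fun s O hO => ?_⟩
  obtain ⟨O', hO'O, hO', hcO'⟩ := mem_nhds_iff.1 hO
  refine Filter.Frequently.filter_mono (f := H) ?_ hH
  by_contra hcon
  rw [not_frequently] at hcon
  refine hc' (toTorus (∑ i, s i • intVec (b' i))) (fun ξ hξ => mFourier_toTorus_eq_one ?_) O'
    (hO'.mem_nhds hcO') (tendsto_const_nhds.congr' (hcon.mono fun j hj => ?_))
  · rw [dotProduct_sum]
    exact Finset.sum_eq_zero fun i _ => by rw [dotProduct_smul, hb'S i ξ hξ, smul_zero]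
  · have : P j ⁻¹' O' = ∅ := Set.eq_empty_of_forall_notMem fun r hr => hj ⟨r, hO'O hr⟩
    beta_reduce
    rw [map_measureReal_apply (hP j).measurable hO'.measurableSet, this, measureReal_empty]

end LimitCosets

/-! ### Minors and the weights of the flow -/

section Minors

variable {ι : Type*}

/-- The real matrix whose columns are the given integer vectors. -/
def colMatrix {e : ℕ} (b : Fin e → ι → ℤ) : Matrix ι (Fin e) ℝ := Matrix.of fun a i => (b i a : ℝ)

theorem colMatrix_col {e : ℕ} (b : Fin e → ι → ℤ) : (colMatrix b).col = fun i => intVec (b i) := rfl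

theorem exists_det_submatrix_colMatrix {e : ℕ} (b : Fin e → ι → ℤ) (I : Fin e → ι) :
    ∃ a : ℤ, ((colMatrix b).submatrix I id).det = a :=
  ⟨Matrix.det (fun i j => b j (I i)), (Int.cast_det _).symm⟩

variable [Fintype ι]

/-- A weak form of the Cauchy–Binet formula: `det (L A)` is a combination of the maximal minors
of `A`, so they cannot all vanish if `A` has a left inverse `L`. -/
theorem exists_minor_ne_zero {e : ℕ} {A : Matrix ι (Fin e) ℝ} (hA : LinearIndependent ℝ A.col) :
    ∃ I : Fin e → ι, (A.submatrix I id).det ≠ 0 := by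
  classical
  by_contra! hcon
  obtain ⟨L, hL⟩ := LinearMap.exists_leftInverse_of_injective A.mulVecLin
    (LinearMap.ker_eq_bot.2 (Matrix.mulVec_injective_iff.2 hA))
  have hLA : L.toMatrix' * A = 1 := by
    have := congrArg LinearMap.toMatrix' hL
    rwa [LinearMap.toMatrix'_comp, LinearMap.toMatrix'_id, ← Matrix.toLin'_apply',
      LinearMap.toMatrix'_toLin'] at this
  have hrows : (L.toMatrix' * A) = fun i => ∑ k, L.toMatrix' i k • A k := by
    funext i j
    simp [Matrix.mul_apply, Finset.sum_apply]
  have hdet : (L.toMatrix' * A).det = 0 := by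
    rw [show (L.toMatrix' * A).det =
      Matrix.detRowAlternating.toMultilinearMap (L.toMatrix' * A) from rfl, hrows,
      MultilinearMap.map_sum]
    refine Finset.sum_eq_zero fun I _ => ?_
    rw [MultilinearMap.map_smul_univ]
    exact smul_eq_zero_of_right _ (hcon I)
  rw [hLA, Matrix.det_one] at hdet
  exact one_ne_zero hdet

theorem map_mul_colMatrix {e : ℕ} (M : Matrix ι ι ℤ) (b : Fin e → ι → ℤ) :
    M.map (Int.cast : ℤ → ℝ) * colMatrix b = colMatrix fun i => M *ᵥ b i := by
  ext a i
  simp [colMatrix, Matrix.mul_apply, Matrix.mulVec, dotProduct]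

end Minors

section Flow

variable {m n : ℕ}

/-- The weights of the flow: `h_t` multiplies the coordinate `a` by `exp (weight a * t)`. -/
def weight (m n : ℕ) : Fin m ⊕ Fin n → ℤ := Sum.elim (fun _ => n) (fun _ => -m)

theorem coe_flow (t : ℝ) : (flow m n t : Matrix (Fin m ⊕ Fin n) (Fin m ⊕ Fin n) ℝ) =
    Matrix.diagonal fun a => Real.exp (weight m n a * t) := by
  change Matrix.fromBlocks _ _ _ _ = _
  rw [Matrix.smul_one_eq_diagonal, Matrix.smul_one_eq_diagonal, Matrix.fromBlocks_diagonal]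
  congr 1
  funext a
  rcases a with a | a <;> simp [weight]

theorem det_flow_mul_submatrix {e : ℕ} (t : ℝ) (A : Matrix (Fin m ⊕ Fin n) (Fin e) ℝ)
    (I : Fin e → Fin m ⊕ Fin n) :
    (((flow m n t).1 * A).submatrix I id).det =
      Real.exp ((∑ i, weight m n (I i) : ℤ) * t) * (A.submatrix I id).det := by
  have : ((flow m n t).1 * A).submatrix I id =
      Matrix.of fun i j => Real.exp (weight m n (I i) * t) * A.submatrix I id i j := by
    ext i j
    rw [Matrix.submatrix_apply, coe_flow, Matrix.diagonal_mul]
    rfl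
  rw [this, Matrix.det_mul_column, ← Real.exp_sum, ← Finset.sum_mul]
  push_cast
  rfl

/-- The weight of a minor is nonzero because `gcd(m, n) = 1`: it is `(m + n) a - m e`,
where `a` of the `e` coordinates are among the first `m`. -/
theorem sum_weight_ne_zero (hmn : Nat.gcd m n = 1) {e : ℕ} (he : 1 ≤ e) (he' : e < m + n)
    (I : Fin e → Fin m ⊕ Fin n) : ∑ i, weight m n (I i) ≠ 0 := by
  intro h
  have h1 : ∀ a, weight m n a = (m + n : ℕ) * (if a.isLeft then 1 else 0) - m := by
    rintro (a | a) <;> simp [weight]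
  simp only [h1, Finset.sum_sub_distrib, ← Finset.mul_sum] at h
  have h2 : ((m + n : ℕ) : ℤ) ∣ ((m * e : ℕ) : ℤ) := by
    refine ⟨∑ i, if (I i).isLeft then 1 else 0, ?_⟩
    simp at h ⊢
    linarith
  have h3 : (m + n) ∣ m * e := Int.natCast_dvd_natCast.1 h2
  have h4 : Nat.Coprime (m + n) m := by
    rw [Nat.coprime_comm]
    simpa [Nat.Coprime] using hmn
  have := Nat.le_of_dvd he (h4.dvd_of_dvd_mul_left h3)
  omega

/-- Let `h_{t_j} g₀ = g_j γ_j` with `t_j → ∞` and `g_j → g₁`. Then the integer matrices `γ_j` cannot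
map a rational subspace of dimension `0 < e < d` to one and the same subspace `W`. Indeed, the
minors of a basis of `W`, transported by `g_j`, are those of a fixed matrix, multiplied by
`exp (ω t_j)` with `ω ≠ 0` and by a factor that is bounded above and below since all minors of
integer matrices are integers. As they converge, they tend to zero, but `g₁` is invertible. -/
theorem not_eventually_span_eq (hmn : Nat.gcd m n = 1) {l : Filter ℕ} [l.NeBot] {t : ℕ → ℝ}
    (ht : Tendsto t l atTop) {g : ℕ → SLd m n} {g₁ g₀ : SLd m n} (hg : Tendsto g l (𝓝 g₁))
    {γ : ℕ → Matrix.SpecialLinearGroup (Fin m ⊕ Fin n) ℤ}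
    (hγ : ∀ j, flow m n (t j) * g₀ = g j * (γ j).map (Int.castRingHom ℝ))
    {e : ℕ} (he : 1 ≤ e) (he' : e < m + n) {b : Fin e → Fin m ⊕ Fin n → ℤ}
    (hli : ∀ j, LinearIndependent ℝ fun i => intVec ((γ j).1 *ᵥ b i))
    (hb : LinearIndependent ℝ fun i => intVec (b i)) (W : Submodule ℝ (Vec m n)) :
    ¬ ∀ᶠ j in l, Submodule.span ℝ (Set.range fun i => intVec ((γ j).1 *ᵥ b i)) = W := by
  intro hW
  obtain ⟨J, hJ⟩ := hW.exists
  let b' : Fin e → Fin m ⊕ Fin n → ℤ := fun i => (γ J).1 *ᵥ b i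
  obtain ⟨I₀, hp⟩ := exists_minor_ne_zero (A := colMatrix b) (by rwa [colMatrix_col])
  obtain ⟨I₁, hq⟩ := exists_minor_ne_zero (A := colMatrix b') (by rw [colMatrix_col]; exact hli J)
  set p := ((colMatrix b).submatrix I₀ id).det
  set q := ((colMatrix b').submatrix I₁ id).det
  have hsub : ∀ (A : Matrix (Fin m ⊕ Fin n) (Fin e) ℝ) (M : Matrix (Fin e) (Fin e) ℝ)
      (I : Fin e → Fin m ⊕ Fin n),
      ((A * M).submatrix I id).det = (A.submatrix I id).det * M.det := fun A M I => by
    rw [← Matrix.det_mul]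
    rfl
  -- the transition matrices between the two bases of `W`, and bounds for their determinants
  have hM : ∀ᶠ j in l, ∃ D : ℝ, D ≠ 0 ∧ |D| ≤ |p| ∧ 1 ≤ |q| * |D| ∧ ∀ I : Fin e → Fin m ⊕ Fin n,
      (((g j).1 * colMatrix b').submatrix I id).det * D =
        Real.exp ((∑ i, weight m n (I i) : ℤ) * t j) *
          ((g₀.1 * colMatrix b).submatrix I id).det := by
    filter_upwards [hW] with j hj
    have hmem : ∀ i, ∃ c : Fin e → ℝ, ∑ k, c k • intVec (b' k) = intVec ((γ j).1 *ᵥ b i) :=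
      fun i => by
        have : intVec ((γ j).1 *ᵥ b i) ∈
            Submodule.span ℝ (Set.range fun i => intVec ((γ J).1 *ᵥ b i)) := by
          rw [hJ, ← hj]
          exact Submodule.subset_span ⟨i, rfl⟩
        exact (Submodule.mem_span_range_iff_exists_fun ℝ).1 this
    choose c hc using hmem
    let M : Matrix (Fin e) (Fin e) ℝ := Matrix.of fun k i => c i k
    have hBM : colMatrix (fun i => (γ j).1 *ᵥ b i) = colMatrix b' * M := by
      ext a i
      have := congrFun (hc i) a
      simp only [Finset.sum_apply, Pi.smul_apply, smul_eq_mul] at this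
      rw [Matrix.mul_apply]
      refine this.symm.trans (Finset.sum_congr rfl fun k _ => mul_comm _ _)
    have hinv : colMatrix b = colMatrix (fun i => (γ j)⁻¹.1 *ᵥ b' i) * M := by
      rw [← map_mul_colMatrix, Matrix.mul_assoc, ← hBM, map_mul_colMatrix]
      congr 1
      funext i
      rw [Matrix.mulVec_mulVec, ← Matrix.SpecialLinearGroup.coe_mul]
      simp
    obtain ⟨a, ha⟩ := exists_det_submatrix_colMatrix (fun i => (γ j)⁻¹.1 *ᵥ b' i) I₀
    obtain ⟨a', ha'⟩ := exists_det_submatrix_colMatrix (fun i => (γ j).1 *ᵥ b i) I₁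
    have hp' : p = a * M.det := by simp only [p]; rw [hinv, hsub, ha]
    have hq' : (a' : ℝ) = q * M.det := by rw [← ha', hBM, hsub]
    have hD : M.det ≠ 0 := fun h => hp (by rw [hp', h, mul_zero])
    have ha1 : (1 : ℝ) ≤ |(a : ℝ)| := by
      have : a ≠ 0 := by rintro rfl; exact hp (by simpa using hp')
      exact_mod_cast Int.one_le_abs this
    have ha1' : (1 : ℝ) ≤ |(a' : ℝ)| := by
      have : a' ≠ 0 := by
        rintro rfl
        exact mul_ne_zero hq hD (by simpa using hq'.symm)
      exact_mod_cast Int.one_le_abs this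
    refine ⟨M.det, hD, ?_, ?_, fun I => ?_⟩
    · rw [hp', abs_mul]
      exact le_mul_of_one_le_left (abs_nonneg _) ha1
    · rwa [← abs_mul, ← hq']
    · rw [← hsub, Matrix.mul_assoc, ← hBM, ← map_mul_colMatrix, ← det_flow_mul_submatrix,
        ← Matrix.mul_assoc, ← Matrix.mul_assoc]
      have := congrArg (fun A : SLd m n => A.1) (hγ j)
      simp only [Matrix.SpecialLinearGroup.coe_mul] at this
      rw [this]
      rfl
  -- hence all minors of the limit vanish
  obtain ⟨I, hI⟩ := exists_minor_ne_zero (A := g₁.1 * colMatrix b') (by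
    have h1 : Function.Injective (colMatrix b').mulVec :=
      Matrix.mulVec_injective_iff.2 (by rw [colMatrix_col]; exact hli J)
    refine Matrix.mulVec_injective_iff.1 fun v w hvw => h1 ?_
    rw [← Matrix.mulVec_mulVec, ← Matrix.mulVec_mulVec] at hvw
    refine Matrix.mulVec_injective_of_isUnit ?_ hvw
    rw [Matrix.isUnit_iff_isUnit_det]
    simp)
  refine hI ?_
  have hlim : Tendsto (fun j => (((g j).1 * colMatrix b').submatrix I id).det) l
      (𝓝 ((g₁.1 * colMatrix b').submatrix I id).det) := by
    have hcont : Continuous fun A : SLd m n =>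
        ((A.1 * colMatrix b').submatrix I id).det := by
      have : Continuous fun A : SLd m n => (A : Matrix (Fin m ⊕ Fin n) (Fin m ⊕ Fin n) ℝ) :=
        continuous_subtype_val
      fun_prop
    exact (hcont.tendsto g₁).comp hg
  set ω : ℤ := ∑ i, weight m n (I i) with hω
  set κ := ((g₀.1 * colMatrix b).submatrix I id).det
  rcases lt_or_gt_of_ne (sum_weight_ne_zero hmn he he' I) with hneg | hpos
  · refine tendsto_nhds_unique hlim (squeeze_zero_norm'
      (a := fun j => Real.exp (ω * t j) * (|κ| * |q|)) (hM.mono ?_) ?_)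
    · rintro j ⟨D, hD, -, hqD, hDI⟩
      have h1 := congrArg abs (hDI I)
      rw [abs_mul, abs_mul, Real.abs_exp] at h1
      rw [Real.norm_eq_abs]
      calc _ ≤ |(((g j).1 * colMatrix b').submatrix I id).det| * (|q| * |D|) :=
            le_mul_of_one_le_right (abs_nonneg _) hqD
        _ = |(((g j).1 * colMatrix b').submatrix I id).det| * |D| * |q| := by ring
        _ = _ := by rw [h1]; ring
    · have h2 : Tendsto (fun j => (ω : ℝ) * t j) l atBot :=
        ht.const_mul_atTop_of_neg (by exact_mod_cast hneg)
      simpa using (Real.tendsto_exp_atBot.comp h2).mul_const (|κ| * |q|)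
  · have hκ : κ = 0 := by
      by_contra hκ
      have h2 : Tendsto (fun j => (ω : ℝ) * t j) l atTop :=
        ht.const_mul_atTop (by exact_mod_cast hpos)
      have h3 : Tendsto (fun j => Real.exp (ω * t j) * |κ|) l atTop :=
        (Real.tendsto_exp_atTop.comp h2).atTop_mul_const (abs_pos.2 hκ)
      refine not_tendsto_nhds_of_tendsto_atTop
        (tendsto_atTop_mono' l (hM.mono ?_) h3) _ (hlim.abs.mul_const |p|)
      rintro j ⟨D, hD, hDp, -, hDI⟩
      have h1 := congrArg abs (hDI I)
      rw [abs_mul, abs_mul, Real.abs_exp] at h1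
      rw [← h1]
      exact mul_le_mul_of_nonneg_left hDp (abs_nonneg _)
    refine tendsto_nhds_unique hlim (tendsto_const_nhds.congr' (hM.mono ?_))
    rintro j ⟨D, hD, -, -, hDI⟩
    have h1 : (((g j).1 * colMatrix b').submatrix I id).det * D = Real.exp (ω * t j) * κ := hDI I
    rw [hκ, mul_zero] at h1
    exact ((mul_eq_zero.1 h1).resolve_right hD).symm

end Flow

/-! ### The spaces of lattices and grids -/

section Space

variable {m n : ℕ}

theorem lin_apply (g : SLd m n) (v : Vec m n) : lin g v = g.1 *ᵥ v := rfl

theorem lin_smul (g : SLd m n) (a : ℝ) (v : Vec m n) : lin g (a • v) = a • lin g v :=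
  Matrix.mulVec_smul g.1 a v

theorem lin_mul_apply (g h : SLd m n) (v : Vec m n) : lin (g * h) v = lin g (lin h v) := by
  rw [lin_mul]; rfl

theorem lin_one_apply (v : Vec m n) : lin (1 : SLd m n) v = v := by
  rw [lin_apply]; simp

theorem lin_inv_lin (g : SLd m n) (v : Vec m n) : lin g⁻¹ (lin g v) = v := by
  rw [← lin_mul_apply, inv_mul_cancel, lin_one_apply]

theorem lin_lin_inv (g : SLd m n) (v : Vec m n) : lin g (lin g⁻¹ v) = v := by
  rw [← lin_mul_apply, mul_inv_cancel, lin_one_apply]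

theorem continuous_lin : Continuous fun p : SLd m n × Vec m n => lin p.1 p.2 := by
  have h : Continuous fun g : SLd m n => (g.1 : Matrix (Fin m ⊕ Fin n) (Fin m ⊕ Fin n) ℝ) :=
    continuous_subtype_val
  exact (h.comp continuous_fst).matrix_mulVec continuous_snd

theorem mem_latticeOf {g : SLd m n} {v : Vec m n} :
    v ∈ latticeOf g ↔ ∃ p, lin g (intVec p) = v := by
  constructor
  · rintro ⟨_, ⟨p, rfl⟩, rfl⟩
    exact ⟨p, rfl⟩
  · rintro ⟨p, rfl⟩
    exact ⟨_, ⟨p, rfl⟩, rfl⟩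

/-- The embedding of `SL_d(ℤ)` into `SL_d(ℝ)`. -/
abbrev realOf (γ : Matrix.SpecialLinearGroup (Fin m ⊕ Fin n) ℤ) : SLd m n :=
  γ.map (Int.castRingHom ℝ)

theorem lin_realOf (γ : Matrix.SpecialLinearGroup (Fin m ⊕ Fin n) ℤ) (v : Vec m n) :
    lin (realOf γ) v = γ.1.map (Int.cast : ℤ → ℝ) *ᵥ v := rfl

theorem lin_realOf_intVec (γ : Matrix.SpecialLinearGroup (Fin m ⊕ Fin n) ℤ)
    (p : Fin m ⊕ Fin n → ℤ) : lin (realOf γ) (intVec p) = intVec (γ.1 *ᵥ p) :=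
  (intVec_mulVec γ.1 p).symm

theorem latticeOf_mul_realOf (g : SLd m n) (γ : Matrix.SpecialLinearGroup (Fin m ⊕ Fin n) ℤ) :
    latticeOf (g * realOf γ) = latticeOf g := by
  ext v
  simp only [mem_latticeOf, lin_mul_apply]
  constructor
  · rintro ⟨p, rfl⟩
    exact ⟨γ.1 *ᵥ p, by rw [lin_realOf_intVec]⟩
  · rintro ⟨p, rfl⟩
    refine ⟨γ⁻¹.1 *ᵥ p, ?_⟩
    rw [lin_realOf_intVec, Matrix.mulVec_mulVec, ← Matrix.SpecialLinearGroup.coe_mul]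
    simp

theorem latticeOf_eq_iff {g h : SLd m n} :
    latticeOf g = latticeOf h ↔ ∃ γ, h = g * realOf γ := by
  constructor
  · intro hgh
    -- the columns of `g⁻¹ h` are integer vectors
    have hcol : ∀ a, ∃ p : Fin m ⊕ Fin n → ℤ, lin (g⁻¹ * h) (Pi.single a 1) = intVec p := by
      intro a
      have h1 : lin h (Pi.single a 1) ∈ latticeOf g := by
        rw [hgh, mem_latticeOf]
        refine ⟨Pi.single a 1, congrArg _ ?_⟩
        funext i
        by_cases hi : i = a
        · subst hi; simp [intVec]
        · simp [intVec, hi]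
      obtain ⟨p, hp⟩ := mem_latticeOf.1 h1
      exact ⟨p, by rw [lin_mul_apply, ← hp, lin_inv_lin]⟩
    choose p hp using hcol
    let M : Matrix (Fin m ⊕ Fin n) (Fin m ⊕ Fin n) ℤ := Matrix.of fun i j => p j i
    have hM : M.map (Int.cast : ℤ → ℝ) = (g⁻¹ * h).1 := by
      ext i j
      have := congrFun (hp j) i
      rw [lin_apply, Matrix.mulVec_single_one] at this
      exact this.symm
    have hdet : M.det = 1 := by
      have h1 : ((M.det : ℤ) : ℝ) = 1 := by rw [Int.cast_det, hM]; exact (g⁻¹ * h).2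
      exact_mod_cast h1
    refine ⟨⟨M, hdet⟩, ?_⟩
    have : realOf ⟨M, hdet⟩ = g⁻¹ * h := Subtype.ext hM
    rw [this, mul_inv_cancel_left]
  · rintro ⟨γ, rfl⟩
    exact (latticeOf_mul_realOf g γ).symm

theorem Lattice.isOpenQuotientMap_of : IsOpenQuotientMap (Lattice.of : SLd m n → Lattice m n) := by
  refine ⟨?_, continuous_coinduced_rng, ?_⟩
  · rintro ⟨_, g, rfl⟩
    exact ⟨g, rfl⟩
  · intro O hO
    rw [isOpen_coinduced]
    have : Lattice.of ⁻¹' (Lattice.of '' O) = ⋃ γ, (fun g : SLd m n => g * realOf γ) ⁻¹' O := by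
      ext g
      simp only [Set.mem_preimage, Set.mem_image, Set.mem_iUnion]
      constructor
      · rintro ⟨h, hh, heq⟩
        obtain ⟨γ, hγ⟩ := latticeOf_eq_iff.1 (congrArg Subtype.val heq).symm
        exact ⟨γ, hγ ▸ hh⟩
      · rintro ⟨γ, hγ⟩
        exact ⟨_, hγ, Subtype.ext (latticeOf_mul_realOf g γ)⟩
    rw [this]
    exact isOpen_iUnion fun γ => hO.preimage (continuous_mul_const _)

theorem act_of (g h : SLd m n) : Lattice.act g (Lattice.of h) = Lattice.of (g * h) :=
  Subtype.ext (latticeOf_mul g h).symm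

/-- Convergence `h_{t_k} x → z` in the space of lattices lifts to the group, with times tending to
infinity, since `SL_d(ℝ) → X` is open. -/
theorem exists_lift_of_mem_boundary {g₀ g₁ : SLd m n}
    (h : Lattice.of g₁ ∈ boundary (Lattice.of g₀)) :
    ∃ (t : ℕ → ℝ) (g : ℕ → SLd m n) (γ : ℕ → Matrix.SpecialLinearGroup (Fin m ⊕ Fin n) ℤ),
      (∀ j, 0 ≤ t j) ∧ Tendsto t atTop atTop ∧ Tendsto g atTop (𝓝 g₁) ∧
        ∀ j, flow m n (t j) * g₀ = g j * realOf (γ j) := by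
  obtain ⟨t, ht0, htub, hlim⟩ := h
  have : FirstCountableTopology (Matrix (Fin m ⊕ Fin n) (Fin m ⊕ Fin n) ℝ) :=
    inferInstanceAs (FirstCountableTopology (Fin m ⊕ Fin n → Fin m ⊕ Fin n → ℝ))
  have : FirstCountableTopology (SLd m n) :=
    (Topology.IsInducing.mk rfl : Topology.IsInducing fun g : SLd m n =>
      (g.1 : Matrix (Fin m ⊕ Fin n) (Fin m ⊕ Fin n) ℝ)).firstCountableTopology
  obtain ⟨O, hO⟩ := (𝓝 g₁).exists_antitone_basis
  have hstep : ∀ j : ℕ, ∃ (k : ℕ) (g : SLd m n),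
      (j : ℝ) ≤ t k ∧ g ∈ O j ∧ Lattice.of g = Lattice.act (flow m n (t k)) (Lattice.of g₀) := by
    intro j
    have h1 : Lattice.of '' O j ∈ 𝓝 (Lattice.of g₁) :=
      Lattice.isOpenQuotientMap_of.isOpenMap.image_mem_nhds (hO.1.mem_of_mem trivial)
    obtain ⟨K, hK⟩ := eventually_atTop.1 (hlim.eventually h1)
    have h2 : ∃ k ≥ K, (j : ℝ) ≤ t k := by
      by_contra! hlt
      refine htub ⟨max j (∑ i ∈ Finset.range K, t i), ?_⟩
      rintro _ ⟨k, rfl⟩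
      rcases le_or_gt K k with hk | hk
      · exact (hlt k hk).le.trans (le_max_left _ _)
      · exact (Finset.single_le_sum (fun i _ => ht0 i) (Finset.mem_range.2 hk)).trans
          (le_max_right _ _)
    obtain ⟨k, hk, hjk⟩ := h2
    obtain ⟨g, hg, hgk⟩ := hK k hk
    exact ⟨k, g, hjk, hg, hgk⟩
  choose k g hk hg hgk using hstep
  have hγ : ∀ j, ∃ γ, flow m n (t (k j)) * g₀ = g j * realOf γ := fun j =>
    latticeOf_eq_iff.1 (congrArg Subtype.val ((hgk j).trans (act_of _ _)))
  choose γ hγ using hγ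
  exact ⟨fun j => t (k j), g, γ, fun j => ht0 _,
    tendsto_atTop_mono hk tendsto_natCast_atTop_atTop, hO.tendsto hg, hγ⟩

/-- The grid `g (ℤ^d + v)`, where `z` is the class of `v` in `ℝ^d / ℤ^d`. -/
def gridAt (g : SLd m n) (z : UnitAddTorus (Fin m ⊕ Fin n)) : Grid m n :=
  ⟨lin g '' (toTorus ⁻¹' {z}), by
    obtain ⟨v, rfl⟩ := isOpenQuotientMap_toTorus.surjective z
    refine ⟨g, lin g v, ?_⟩
    ext w
    simp only [gridOf, mem_latticeOf, Set.mem_ofPred_eq, Set.mem_image, Set.mem_preimage,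
      Set.mem_singleton_iff]
    constructor
    · rintro ⟨_, ⟨p, rfl⟩, rfl⟩
      refine ⟨v + intVec p, (toTorus_eq_iff.2 ⟨p, rfl⟩).symm, ?_⟩
      rw [map_add, add_comm]
    · rintro ⟨u, hu, rfl⟩
      obtain ⟨p, rfl⟩ := toTorus_eq_iff.1 hu.symm
      refine ⟨_, ⟨p, rfl⟩, ?_⟩
      rw [map_add, add_comm]
      rfl⟩

theorem mem_gridAt {g : SLd m n} {z : UnitAddTorus (Fin m ⊕ Fin n)} {w : Vec m n} :
    w ∈ (gridAt g z).1 ↔ toTorus (lin g⁻¹ w) = z := by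
  constructor
  · rintro ⟨v, hv, rfl⟩
    rw [lin_inv_lin]
    exact hv
  · intro h
    exact ⟨_, h, lin_lin_inv g w⟩

theorem gridAt_toTorus (g : SLd m n) (v : Vec m n) :
    gridAt g (toTorus v) = Grid.of (g, lin g v) := by
  refine Subtype.ext (Set.ext fun w => ?_)
  rw [mem_gridAt]
  simp only [Grid.of, gridOf, mem_latticeOf, Set.mem_ofPred_eq]
  rw [eq_comm, toTorus_eq_iff]
  constructor
  · rintro ⟨p, hp⟩
    refine ⟨_, ⟨p, rfl⟩, ?_⟩
    rw [← lin_lin_inv g w, hp, map_add, add_comm]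
    rfl
  · rintro ⟨_, ⟨p, rfl⟩, rfl⟩
    refine ⟨p, ?_⟩
    rw [map_add, lin_inv_lin, lin_inv_lin, add_comm]
    rfl

theorem continuous_gridAt :
    Continuous fun p : SLd m n × UnitAddTorus (Fin m ⊕ Fin n) => gridAt p.1 p.2 := by
  have hq : IsOpenQuotientMap (Prod.map id toTorus :
      SLd m n × Vec m n → SLd m n × UnitAddTorus (Fin m ⊕ Fin n)) :=
    IsOpenQuotientMap.id.prodMap isOpenQuotientMap_toTorus
  rw [← hq.continuous_comp_iff]
  have : (fun p : SLd m n × UnitAddTorus (Fin m ⊕ Fin n) => gridAt p.1 p.2) ∘ Prod.map id toTorus =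
      Grid.of ∘ fun p : SLd m n × Vec m n => (p.1, lin p.1 p.2) :=
    funext fun p => gridAt_toTorus p.1 p.2
  rw [this]
  exact continuous_coinduced_rng.comp (continuous_fst.prodMk continuous_lin)

theorem act_gridAt (h g : SLd m n) (z : UnitAddTorus (Fin m ⊕ Fin n)) :
    Grid.act h (gridAt g z) = gridAt (h * g) z := by
  refine Subtype.ext ?_
  change lin h '' (lin g '' _) = lin (h * g) '' _
  rw [Set.image_image]
  simp only [lin_mul_apply]

theorem gridAt_mul_realOf (g : SLd m n) (γ : Matrix.SpecialLinearGroup (Fin m ⊕ Fin n) ℤ)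
    (z : UnitAddTorus (Fin m ⊕ Fin n)) : gridAt (g * realOf γ) z = gridAt g (torusMap γ.1 z) := by
  obtain ⟨v, rfl⟩ := isOpenQuotientMap_toTorus.surjective z
  rw [torusMap_toTorus, gridAt_toTorus, gridAt_toTorus]
  refine Subtype.ext (Set.ext fun w => ?_)
  simp only [Grid.of, gridOf, latticeOf_mul_realOf, lin_mul_apply, lin_realOf]

theorem continuous_gridAct (h : SLd m n) : Continuous (Grid.act h : Grid m n → Grid m n) := by
  refine continuous_coinduced_dom.2 ?_
  have : Grid.act h ∘ Grid.of = Grid.of ∘ fun p : SLd m n × Vec m n => (h * p.1, lin h p.2) := by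
    funext p
    have h1 := gridAt_toTorus p.1 (lin p.1⁻¹ p.2)
    have h2 := gridAt_toTorus (h * p.1) (lin p.1⁻¹ p.2)
    rw [lin_lin_inv] at h1
    rw [lin_mul_apply, lin_lin_inv] at h2
    rw [Function.comp_apply, Function.comp_apply, ← h2, ← act_gridAt, h1]
  rw [this]
  have h1 : Continuous fun p : SLd m n × Vec m n => h * p.1 := continuous_fst.const_mul h
  have h2 : Continuous fun p : SLd m n × Vec m n => lin h p.2 :=
    continuous_lin.comp (continuous_const.prodMk continuous_snd)
  exact continuous_coinduced_rng.comp (h1.prodMk h2)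

theorem toGrid_mk (g : SLd m n) (w : Vec m n) :
    Torus.toGrid (Lattice.of g) (QuotientAddGroup.mk w) = gridAt g (toTorus (lin g⁻¹ w)) := by
  rw [gridAt_toTorus, lin_lin_inv]
  refine Subtype.ext (Set.ext fun v => ?_)
  simp only [Torus.toGrid, Grid.of, gridOf, Set.mem_ofPred_eq]
  rw [eq_comm, QuotientAddGroup.eq]
  constructor
  · intro h
    exact ⟨_, h, by abel⟩
  · rintro ⟨u, hu, rfl⟩
    have : -w + (u + w) = u := by abel
    rw [this]
    exact hu

theorem flow_add (s t : ℝ) : flow m n (s + t) = flow m n s * flow m n t := by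
  refine Subtype.ext ?_
  change (flow m n (s + t)).1 = (flow m n s).1 * (flow m n t).1
  rw [coe_flow, coe_flow, coe_flow, Matrix.diagonal_mul_diagonal]
  congr 1
  funext a
  rw [← Real.exp_add, mul_add]

theorem act_mul (g h : SLd m n) (y : Grid m n) :
    Grid.act (g * h) y = Grid.act g (Grid.act h y) := by
  refine Subtype.ext ?_
  change lin (g * h) '' _ = lin g '' (lin h '' _)
  rw [Set.image_image]
  simp only [lin_mul_apply]

theorem act_mem_orbitClosure {y z : Grid m n} (hz : z ∈ orbitClosure y) {t : ℝ} (ht : 0 ≤ t) :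
    Grid.act (flow m n t) z ∈ orbitClosure y := by
  refine map_mem_closure (continuous_gridAct _) hz ?_
  rintro _ ⟨s, hs, rfl⟩
  exact ⟨t + s, add_nonneg ht hs, by rw [flow_add, act_mul]⟩

/-- A grid is in the closure of `Ω` if it is approximated by grids in `Ω`, where the approximation
may be tested separately for the lattice and for the class of the translation. -/
theorem gridAt_mem_closure {Ω : Set (Grid m n)} {g : ℕ → SLd m n} {g₁ : SLd m n}
    (hg : Tendsto g atTop (𝓝 g₁)) {z : UnitAddTorus (Fin m ⊕ Fin n)}
    (h : ∀ O ∈ 𝓝 z, ∃ᶠ j in atTop, ∃ z' ∈ O, gridAt (g j) z' ∈ Ω) : gridAt g₁ z ∈ closure Ω := by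
  rw [mem_closure_iff_nhds]
  intro N hN
  have h1 := (continuous_gridAt.tendsto (g₁, z)).eventually hN
  rw [nhds_prod_eq, eventually_prod_iff] at h1
  obtain ⟨p, hp, q, hq, hpq⟩ := h1
  obtain ⟨j, ⟨z', hz', hj⟩, hpj⟩ := ((h {z | q z} hq).and_eventually (hg.eventually hp)).exists
  exact ⟨_, hpq hpj hz', hj⟩

end Space

/-! ### Cosets in orbit closures -/

section Cosets

variable {m n : ℕ}

/-- `Ω` contains a translate of an `e`-dimensional subtorus of `ℝ^d / x`. In coordinates with
`x = g ℤ^d`, the subtorus is the image of the real span of `e` independent integer vectors. -/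
def ContainsCoset (Ω : Set (Grid m n)) (x : Lattice m n) (e : ℕ) : Prop :=
  ∃ (g : SLd m n) (b : Fin e → Fin m ⊕ Fin n → ℤ) (c : Vec m n), Lattice.of g = x ∧
    LinearIndependent ℝ (fun i => intVec (b i)) ∧
      ∀ s : Fin e → ℝ, gridAt g (toTorus (c + ∑ i, s i • intVec (b i))) ∈ Ω

theorem linearIndependent_intVec_mulVec (γ : Matrix.SpecialLinearGroup (Fin m ⊕ Fin n) ℤ)
    {e : ℕ} {b : Fin e → Fin m ⊕ Fin n → ℤ} (hb : LinearIndependent ℝ fun i => intVec (b i)) :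
    LinearIndependent ℝ fun i => intVec (γ.1 *ᵥ b i) := by
  have h : LinearIndependent ℝ (Matrix.mulVecLin (realOf γ).1 ∘ fun i => intVec (b i)) := by
    refine hb.map' _ (LinearMap.ker_eq_bot.2 fun v w hvw => ?_)
    have h1 : lin (realOf γ) v = lin (realOf γ) w := hvw
    rw [← lin_inv_lin (realOf γ) v, h1, lin_inv_lin]
  convert h using 2 with i
  exact (lin_realOf_intVec γ (b i)).symm

/-- An orbit closure that contains an `e`-dimensional coset over `x`, with `0 < e < d`, contains an
`(e + 1)`-dimensional coset over each accumulation point of `x`. -/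
theorem ContainsCoset.succ (hmn : Nat.gcd m n = 1) {y : Grid m n} {x z : Lattice m n} {e : ℕ}
    (he : 1 ≤ e) (he' : e < m + n) (h : ContainsCoset (orbitClosure y) x e)
    (hz : z ∈ boundary x) : ContainsCoset (orbitClosure y) z (e + 1) := by
  obtain ⟨g₀, b, c, rfl, hb, hbc⟩ := h
  obtain ⟨g₁, rfl⟩ := Lattice.isOpenQuotientMap_of.surjective z
  obtain ⟨t, g, γ, ht0, ht, hg, hγ⟩ := exists_lift_of_mem_boundary hz
  have hli := fun j => linearIndependent_intVec_mulVec (γ j) hb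
  obtain ⟨b', c', hb', hlim⟩ := exists_larger_limit_coset (γ := fun j => (γ j).1) c hli
    (fun l hl hle W => not_eventually_span_eq hmn (ht.mono_left hle) (hg.mono_left hle) hγ he he'
      hli hb W)
  refine ⟨g₁, b', c', rfl, hb', fun s => ?_⟩
  have hcl : closure (orbitClosure y) = orbitClosure y := closure_closure
  rw [← hcl]
  refine gridAt_mem_closure hg fun O hO => (hlim s O hO).mono ?_
  rintro j ⟨r, hr⟩
  refine ⟨_, hr, ?_⟩
  rw [← gridAt_mul_realOf, ← hγ, ← act_gridAt]
  exact act_mem_orbitClosure (hbc r) (ht0 j)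

/-- The identification `ℝ^d / g ℤ^d → ℝ^d / ℤ^d`. -/
def torusCoord (g : SLd m n) (y : Torus (Lattice.of g)) : UnitAddTorus (Fin m ⊕ Fin n) :=
  toTorus (lin g⁻¹ y.out)

theorem torusCoord_mk (g : SLd m n) (w : Vec m n) :
    torusCoord g (QuotientAddGroup.mk w) = toTorus (lin g⁻¹ w) := by
  have h : -w + (QuotientAddGroup.mk w : Torus (Lattice.of g)).out ∈ latticeOf g :=
    QuotientAddGroup.eq.1 (QuotientAddGroup.out_eq' _).symm
  obtain ⟨p, hp⟩ := mem_latticeOf.1 h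
  refine (toTorus_eq_iff.2 ⟨p, ?_⟩).symm
  have h1 : (QuotientAddGroup.mk w : Torus (Lattice.of g)).out = w + lin g (intVec p) := by
    rw [hp]; abel
  rw [h1, map_add, lin_inv_lin]
  rfl

theorem toGrid_eq_gridAt (g : SLd m n) (y : Torus (Lattice.of g)) :
    Torus.toGrid (Lattice.of g) y = gridAt g (torusCoord g y) := by
  obtain ⟨w, rfl⟩ := QuotientAddGroup.mk_surjective y
  rw [toGrid_mk, torusCoord_mk]

theorem continuous_lin_right (g : SLd m n) : Continuous (lin g) :=
  continuous_lin.comp (continuous_const.prodMk continuous_id)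

theorem measurable_torusCoord (g : SLd m n) : Measurable (torusCoord g) := by
  refine QuotientAddGroup.measurable_from_quotient.2 ?_
  have : torusCoord g ∘ QuotientAddGroup.mk = toTorus ∘ lin g⁻¹ := funext (torusCoord_mk g)
  rw [this]
  exact (isOpenQuotientMap_toTorus.continuous.comp (continuous_lin_right _)).measurable

/-- For almost every grid, the orbit closure contains a one-dimensional coset over each
accumulation point of the lattice. Invariance under one lattice vector `u` in the direction of `μ`
suffices: `γ j u` takes no value infinitely often, since otherwise `h_{t_j}` would map the line of
`u` to a constant rational line. -/
theorem ae_containsCoset_one (hm : 1 ≤ m) (hn : 1 ≤ n) (hmn : Nat.gcd m n = 1) {x z : Lattice m n}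
    (hz : z ∈ boundary x) {μ : Measure (Torus x)} (hμ : IsNontrivialAlgebraic x μ) :
    ∀ᵐ y ∂μ, ContainsCoset (orbitClosure (Torus.toGrid x y)) z 1 := by
  obtain ⟨g₀, rfl⟩ := Lattice.isOpenQuotientMap_of.surjective x
  obtain ⟨g₁, rfl⟩ := Lattice.isOpenQuotientMap_of.surjective z
  obtain ⟨hprob, U, -, hU, hrat, -, hinv⟩ := hμ
  obtain ⟨t, g, γ, ht0, ht, hg, hγ⟩ := exists_lift_of_mem_boundary hz
  -- a nonzero lattice vector in `U`
  have hex : ∃ p : Fin m ⊕ Fin n → ℤ, p ≠ 0 ∧ lin g₀ (intVec p) ∈ U := by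
    by_contra! hcon
    refine hU (hrat ▸ (Submodule.span_eq_bot.2 ?_))
    rintro _ ⟨hv, hvx⟩
    obtain ⟨p, rfl⟩ := mem_latticeOf.1 hvx
    by_cases hp : p = 0
    · subst hp
      simp [intVec_eq_zero.2]
    · exact absurd hv (hcon p hp)
  obtain ⟨u, hu0, huU⟩ := hex
  have hli : LinearIndependent ℝ fun _ : Fin 1 => intVec u :=
    LinearIndependent.of_subsingleton 0 fun h => hu0 (intVec_eq_zero.1 h)
  have hprob' : IsProbabilityMeasure (μ.map (torusCoord g₀)) :=
    Measure.isProbabilityMeasure_map (measurable_torusCoord g₀).aemeasurable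
  obtain ⟨b, hb, hae⟩ := exists_ae_forall_mapClusterPt (μ := μ.map (torusCoord g₀)) (u := u)
    (γ := fun j => (γ j).1) (fun s => by
      have hmeas : Measurable fun y : Torus (Lattice.of g₀) =>
          y + (QuotientAddGroup.mk (s • lin g₀ (intVec u)) : Torus (Lattice.of g₀)) := by
        refine QuotientAddGroup.measurable_from_quotient.2 ?_
        exact QuotientAddGroup.measurable_coe.comp (measurable_id.add_const _)
      rw [Measure.map_map (by fun_prop) (measurable_torusCoord g₀)]
      conv_rhs => rw [← hinv _ (U.smul_mem s huU),
        Measure.map_map (measurable_torusCoord g₀) hmeas]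
      congr 1
      funext y
      obtain ⟨w, rfl⟩ := QuotientAddGroup.mk_surjective y
      simp only [Function.comp_apply]
      rw [← QuotientAddGroup.mk_add, torusCoord_mk, torusCoord_mk, map_add, toTorus_add]
      congr 2
      rw [lin_smul, lin_inv_lin])
    (fun p => by
      by_contra hcon
      rw [not_eventually] at hcon
      have hfreq : ∃ᶠ j in atTop, (γ j).1 *ᵥ u = p := hcon.mono fun j hj => not_not.1 hj
      have : (atTop ⊓ 𝓟 {j | (γ j).1 *ᵥ u = p}).NeBot := frequently_mem_iff_neBot.1 hfreq
      refine not_eventually_span_eq hmn (ht.mono_left inf_le_left)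
        (hg.mono_left (inf_le_left (b := 𝓟 {j | (γ j).1 *ᵥ u = p}))) hγ
        le_rfl (by omega) (b := fun _ => u) (fun j => linearIndependent_intVec_mulVec _ hli) hli
        (Submodule.span ℝ (Set.range fun _ : Fin 1 => intVec p)) ?_
      filter_upwards [mem_inf_of_right (mem_principal_self _)] with j hj
      rw [show (γ j).1 *ᵥ u = p from hj])
  filter_upwards [ae_of_ae_map (measurable_torusCoord g₀).aemeasurable hae] with y ⟨c, hc⟩
  refine ⟨g₁, fun _ => b, c, rfl,
    LinearIndependent.of_subsingleton 0 fun h => hb (intVec_eq_zero.1 h), fun s => ?_⟩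
  refine gridAt_mem_closure hg fun O hO => ?_
  rw [Finset.univ_unique, Finset.sum_singleton] at hO
  refine (mapClusterPt_iff_frequently.1 (hc (s default)) O hO).mono fun j hj => ⟨_, hj, ?_⟩
  refine ⟨t j, ht0 j, ?_⟩
  rw [toGrid_eq_gridAt, act_gridAt, hγ, gridAt_mul_realOf]

theorem containsCoset_of_accumulation (hmn : Nat.gcd m n = 1) {k : ℕ} (hk : k + 1 = m + n)
    {x : Lattice m n} {s : Fin (k + 1) → Lattice m n} (hs : IsAccumulationSequence x s)
    {y : Grid m n} (hk1 : 1 ≤ k)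
    (h1 : ContainsCoset (orbitClosure y) (s ⟨1, by omega⟩) 1) :
    ContainsCoset (orbitClosure y) (s (Fin.last k)) k := by
  have h : ∀ i : ℕ, ∀ hi : i + 1 < k + 1,
      ContainsCoset (orbitClosure y) (s ⟨i + 1, hi⟩) (i + 1) := by
    intro i
    induction i with
    | zero => exact fun _ => h1
    | succ i ih =>
      exact fun hi => (ih (by omega)).succ hmn (by omega) (by omega) (hs.2 ⟨i + 1, by omega⟩)
  obtain ⟨i, rfl⟩ : ∃ i, k = i + 1 := ⟨k - 1, by omega⟩
  exact h i (by omega)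

theorem ContainsCoset.exists_coset_subset {Ω : Set (Grid m n)} {x : Lattice m n} {e : ℕ}
    (h : ContainsCoset Ω x e) : ∃ (U : Submodule ℝ (Vec m n)) (v : Vec m n),
      IsRational x U ∧ Module.finrank ℝ U = e ∧ Torus.toGrid x '' coset x U v ⊆ Ω := by
  obtain ⟨g, b, c, rfl, hb, hΩ⟩ := h
  have hlin : ∀ v, lin g v = Matrix.mulVecLin g.1 v := fun _ => rfl
  refine ⟨Submodule.span ℝ (Set.range fun i => lin g (intVec (b i))), lin g c, ?_, ?_, ?_⟩
  · refine le_antisymm (Submodule.span_le.2 fun v hv => hv.1) (Submodule.span_mono ?_)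
    rintro _ ⟨i, rfl⟩
    exact ⟨Submodule.subset_span ⟨i, rfl⟩, mem_latticeOf.2 ⟨b i, rfl⟩⟩
  · have hli : LinearIndependent ℝ fun i => lin g (intVec (b i)) :=
      hb.map' (Matrix.mulVecLin g.1) (LinearMap.ker_eq_bot.2 fun v w hvw => by
        have h1 : lin g v = lin g w := hvw
        rw [← lin_inv_lin g v, h1, lin_inv_lin])
    rw [finrank_span_eq_card hli, Fintype.card_fin]
  · rintro _ ⟨_, ⟨u, hu, rfl⟩, rfl⟩
    obtain ⟨r, rfl⟩ := (Submodule.mem_span_range_iff_exists_fun ℝ).1 hu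
    rw [toGrid_mk, map_add, lin_inv_lin]
    have : lin g⁻¹ (∑ i, r i • lin g (intVec (b i))) = ∑ i, r i • intVec (b i) := by
      have h1 : ∑ i, r i • lin g (intVec (b i)) = lin g (∑ i, r i • intVec (b i)) := by
        simp only [hlin, map_sum, map_smul]
      rw [h1, lin_inv_lin]
    rw [this]
    exact hΩ r

end Cosets

/-! ### Values of the form on grids -/

section Values

theorem continuous_seminorm {d : ℕ} (N : Seminorm ℝ (Fin d → ℝ)) : Continuous N :=
  continuousOn_univ.1 (N.convexOn.continuousOn isOpen_univ)

variable {m n : ℕ} (N₁ : Seminorm ℝ (Fin m → ℝ)) (N₂ : Seminorm ℝ (Fin n → ℝ))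

theorem continuous_F : Continuous (F N₁ N₂) := by
  have h1 := continuous_seminorm N₁
  have h2 := continuous_seminorm N₂
  unfold F
  fun_prop

theorem F_nonneg (u : Vec m n) : 0 ≤ F N₁ N₂ u :=
  mul_nonneg (pow_nonneg (apply_nonneg _ _) _) (pow_nonneg (apply_nonneg _ _) _)

theorem F_smul_smul (a b : ℝ) (v : Fin m → ℝ) (w : Fin n → ℝ) :
    F N₁ N₂ (Sum.elim (a • v) (b • w)) = |a| ^ m * |b| ^ n * (N₁ v ^ m * N₂ w ^ n) := by
  have h1 : N₁ (a • v) = |a| * N₁ v := by rw [map_smul_eq_mul, Real.norm_eq_abs]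
  have h2 : N₂ (b • w) = |b| * N₂ w := by rw [map_smul_eq_mul, Real.norm_eq_abs]
  change N₁ (a • v) ^ m * N₂ (b • w) ^ n = _
  rw [h1, h2, mul_pow, mul_pow]
  ring

theorem F_flow (t : ℝ) (u : Vec m n) : F N₁ N₂ (lin (flow m n t) u) = F N₁ N₂ u := by
  have h : lin (flow m n t) u = Sum.elim (Real.exp (n * t) • fun i => u (Sum.inl i))
      (Real.exp (-m * t) • fun j => u (Sum.inr j)) := by
    funext a
    rw [lin_apply, coe_flow, Matrix.mulVec_diagonal]
    rcases a with a | a <;> simp [weight]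
  rw [h, F_smul_smul, Real.abs_exp, Real.abs_exp, ← Real.exp_nat_mul, ← Real.exp_nat_mul,
    ← Real.exp_add, show (m : ℝ) * (n * t) + n * (-m * t) = 0 by ring, Real.exp_zero, one_mul]
  rfl

/-- The values on a grid in the orbit closure are limits of values on the original grid. -/
theorem F_mem_closure_of_mem_orbitClosure {y z : Grid m n} (hz : z ∈ orbitClosure y) {w : Vec m n}
    (hw : w ∈ z.1) : F N₁ N₂ w ∈ closure (F N₁ N₂ '' y.1) := by
  let C : Set (Grid m n) := {z | ∀ w ∈ z.1, F N₁ N₂ w ∈ closure (F N₁ N₂ '' y.1)}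
  have hC : IsClosed C := by
    rw [isClosed_coinduced]
    have : Grid.of ⁻¹' C = ⋂ p : Fin m ⊕ Fin n → ℤ, {q : SLd m n × Vec m n |
        F N₁ N₂ (lin q.1 (intVec p) + q.2) ∈ closure (F N₁ N₂ '' y.1)} := by
      ext q
      simp only [Set.mem_preimage, Set.mem_iInter, C, Grid.of, gridOf, mem_latticeOf,
        Set.mem_ofPred_eq]
      constructor
      · exact fun h p => h _ ⟨_, ⟨p, rfl⟩, rfl⟩
      · rintro h _ ⟨_, ⟨p, rfl⟩, rfl⟩
        exact h p
    rw [this]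
    refine isClosed_iInter fun p => isClosed_closure.preimage ((continuous_F N₁ N₂).comp ?_)
    have h1 : Continuous fun q : SLd m n × Vec m n => lin q.1 (intVec p) :=
      continuous_lin.comp (continuous_fst.prodMk continuous_const)
    exact h1.add continuous_snd
  have hsub : orbitClosure y ⊆ C := by
    refine closure_minimal ?_ hC
    rintro _ ⟨t, -, rfl⟩ _ ⟨v, hv, rfl⟩
    rw [F_flow]
    exact subset_closure ⟨v, hv, rfl⟩
  exact hsub hz w hw

/-- On a suitable path, `F` takes all nonnegative values by the intermediate value theorem. -/
theorem exists_F_eq (hN₁ : ∀ v, N₁ v = 0 → v = 0) (hN₂ : ∀ w, N₂ w = 0 → w = 0)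
    {v : Fin m → ℝ} {w : Fin n → ℝ} (hv : v ≠ 0) (hw : w ≠ 0) {p q : ℝ → ℝ}
    (hp : Continuous p) (hq : Continuous q) (h0 : ∃ s, |p s| ^ m * |q s| ^ n = 0)
    (hbig : ∀ R, 0 ≤ R → ∃ s, R ≤ |p s| ^ m * |q s| ^ n) {r : ℝ} (hr : 0 ≤ r) :
    ∃ s, F N₁ N₂ (Sum.elim (p s • v) (q s • w)) = r := by
  set κ := N₁ v ^ m * N₂ w ^ n with hκ
  have hκ0 : 0 < κ :=
    mul_pos (pow_pos ((apply_nonneg _ _).lt_of_ne fun h => hv (hN₁ v h.symm)) _)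
      (pow_pos ((apply_nonneg _ _).lt_of_ne fun h => hw (hN₂ w h.symm)) _)
  simp only [F_smul_smul, ← hκ]
  have hcont : Continuous fun s => |p s| ^ m * |q s| ^ n * κ := by fun_prop
  obtain ⟨s₀, hs₀⟩ := h0
  obtain ⟨s₁, hs₁⟩ := hbig (r / κ) (by positivity)
  exact mem_range_of_exists_le_of_exists_ge hcont ⟨s₀, by rw [hs₀, zero_mul]; exact hr⟩
    ⟨s₁, (div_le_iff₀ hκ0).1 hs₁⟩

/-- `F` takes all nonnegative values on each affine hyperplane that misses the origin. -/
theorem exists_mem_hyperplane_F_eq (hm : 1 ≤ m) (hn : 1 ≤ n)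
    (hN₁ : ∀ v, N₁ v = 0 → v = 0) (hN₂ : ∀ w, N₂ w = 0 → w = 0)
    {φ : Vec m n →ₗ[ℝ] ℝ} (hφ : φ ≠ 0) {c : ℝ} (hc : c ≠ 0) {r : ℝ} (hr : 0 ≤ r) :
    ∃ w, φ w = c ∧ F N₁ N₂ w = r := by
  have hm0 : m ≠ 0 := by omega
  have hn0 : n ≠ 0 := by omega
  -- the restrictions of `φ` to the two summands
  let α : (Fin m → ℝ) →ₗ[ℝ] ℝ :=
    { toFun := fun v => φ (Sum.elim v 0)
      map_add' := fun v w => by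
        rw [← map_add]; congr 1; funext a; rcases a with a | a <;> simp
      map_smul' := fun a v => by
        rw [← map_smul]; congr 1; funext a; rcases a with a | a <;> simp }
  let β : (Fin n → ℝ) →ₗ[ℝ] ℝ :=
    { toFun := fun v => φ (Sum.elim 0 v)
      map_add' := fun v w => by
        rw [← map_add]; congr 1; funext a; rcases a with a | a <;> simp
      map_smul' := fun a v => by
        rw [← map_smul]; congr 1; funext a; rcases a with a | a <;> simp }
  have hαβ : ∀ v w, φ (Sum.elim v w) = α v + β w := fun v w => by
    change _ = φ (Sum.elim v 0) + φ (Sum.elim 0 w)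
    rw [← map_add]; congr 1; funext a; rcases a with a | a <;> simp
  have hone : ∀ {d : ℕ} (f : (Fin d → ℝ) →ₗ[ℝ] ℝ), f ≠ 0 → ∃ v, f v = 1 := fun f hf =>
    LinearMap.surjective hf 1
  have hne : ∀ {d : ℕ} (f : (Fin d → ℝ) →ₗ[ℝ] ℝ) {v}, f v = 1 → v ≠ 0 := by
    rintro d f v hv rfl
    simp at hv
  have hex : ∀ {d : ℕ}, 1 ≤ d → ∃ v : Fin d → ℝ, v ≠ 0 := fun {d} hd =>
    ⟨fun _ => 1, fun h => one_ne_zero (congrFun h ⟨0, hd⟩)⟩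
  have hpow : ∀ (R : ℝ) {d : ℕ}, 0 ≤ R → d ≠ 0 → R ≤ |R + 1| ^ d := fun R d hR hd => by
    have h1 : 1 ≤ |R + 1| := by rw [abs_of_nonneg (by linarith)]; linarith
    calc R ≤ |R + 1| := by rw [abs_of_nonneg (by linarith)]; linarith
      _ ≤ |R + 1| ^ d := le_self_pow₀ h1 hd
  have hcn : ∀ d : ℕ, 0 < |c| ^ d := fun d => pow_pos (abs_pos.2 hc) d
  by_cases hα : α = 0
  · have hβ : β ≠ 0 := fun hβ => hφ (LinearMap.ext fun u => by
      rw [← Sum.elim_comp_inl_inr u, hαβ, hα, hβ]; simp)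
    obtain ⟨w, hw⟩ := hone β hβ
    obtain ⟨v, hv⟩ := hex hm
    obtain ⟨s, hs⟩ := exists_F_eq N₁ N₂ hN₁ hN₂ hv (hne β hw) continuous_id
      (continuous_const (y := c)) ⟨0, by simp [hm0]⟩ (fun R hR => ⟨R / |c| ^ n + 1, by
        rw [← div_le_iff₀ (hcn n)]
        exact hpow _ (div_nonneg hR (hcn n).le) hm0⟩) hr
    exact ⟨_, by rw [hαβ, hα, LinearMap.zero_apply, zero_add, map_smul, hw]; simp, hs⟩
  obtain ⟨v, hv⟩ := hone α hα
  by_cases hβ : β = 0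
  · obtain ⟨w, hw⟩ := hex hn
    obtain ⟨s, hs⟩ := exists_F_eq N₁ N₂ hN₁ hN₂ (hne α hv) hw (continuous_const (y := c))
      continuous_id ⟨0, by simp [hn0]⟩ (fun R hR => ⟨R / |c| ^ m + 1, by
        rw [mul_comm, ← div_le_iff₀ (hcn m)]
        exact hpow _ (div_nonneg hR (hcn m).le) hn0⟩) hr
    exact ⟨_, by rw [hαβ, hβ, LinearMap.zero_apply, add_zero, map_smul, hv]; simp, hs⟩
  · obtain ⟨w, hw⟩ := hone β hβ
    obtain ⟨s, hs⟩ := exists_F_eq N₁ N₂ hN₁ hN₂ (hne α hv) (hne β hw) continuous_id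
      (continuous_const.sub continuous_id : Continuous fun s => c - s) ⟨0, by simp [hm0]⟩
      (fun R hR => ⟨|c| + R + 1, by
        have h1 : (1 : ℝ) ≤ |(|c| + R + 1)| ^ m := by
          refine one_le_pow₀ ?_
          rw [abs_of_nonneg (by positivity)]
          linarith [abs_nonneg c]
        have h2 : R + 1 ≤ |c - (|c| + R + 1)| := by
          rw [abs_sub_comm]
          exact le_trans (by linarith [le_abs_self c]) (le_abs_self _)
        have h3 : R ≤ |c - (|c| + R + 1)| ^ n :=
          (by linarith : R ≤ |c - (|c| + R + 1)|).trans (le_self_pow₀ (by linarith) hn0)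
        exact h3.trans (le_mul_of_one_le_left (by positivity) h1)⟩) hr
    exact ⟨_, by rw [hαβ, map_smul, map_smul, hv, hw]; simp, hs⟩

/-- If the orbit closure contains a coset of a subtorus of codimension one, then the grid has dense
values: the grids in the coset cover an affine hyperplane missing the origin, on which `F` takes
all nonnegative values. -/
theorem isDV_of_coset_subset (hm : 1 ≤ m) (hn : 1 ≤ n)
    (hN₁ : ∀ v, N₁ v = 0 → v = 0) (hN₂ : ∀ w, N₂ w = 0 → w = 0) {y : Grid m n} {x : Lattice m n}
    {U : Submodule ℝ (Vec m n)} {v : Vec m n} (hU : Module.finrank ℝ U = m + n - 1)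
    (h : Torus.toGrid x '' coset x U v ⊆ orbitClosure y) : IsDV N₁ N₂ y := by
  refine (closure_minimal ?_ isClosed_Ici).antisymm fun r hr => ?_
  · rintro _ ⟨u, -, rfl⟩
    exact F_nonneg N₁ N₂ u
  have hd : Module.finrank ℝ (Vec m n) = m + n := by simp
  have hlt : U < ⊤ := by
    refine lt_top_iff_ne_top.2 fun h => ?_
    rw [h, finrank_top, hd] at hU
    omega
  obtain ⟨φ, hφ, hUφ⟩ := U.exists_le_ker_of_lt_top hlt
  have hker : U = LinearMap.ker φ := by
    refine Submodule.eq_of_le_of_finrank_le hUφ ?_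
    have h1 : LinearMap.ker φ < ⊤ :=
      lt_top_iff_ne_top.2 fun h => hφ (LinearMap.ker_eq_top.1 h)
    have h2 := Submodule.finrank_lt h1.ne
    omega
  -- some lattice translate of `v + U` misses the origin
  obtain ⟨g, rfl⟩ := Lattice.isOpenQuotientMap_of.surjective x
  have hl : ∃ l ∈ latticeOf g, φ (v + l) ≠ 0 := by
    by_contra! hcon
    have h0 : ∀ l ∈ latticeOf g, φ l = 0 := fun l hl => by
      have h1 := hcon l hl
      have h2 := hcon 0 (zero_mem _)
      rw [map_add] at h1 h2
      rw [map_zero, add_zero] at h2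
      rwa [h2, zero_add] at h1
    have h3 : φ ∘ₗ Matrix.mulVecLin g.1 = 0 := by
      refine LinearMap.pi_ext' fun a => LinearMap.ext_ring ?_
      have h4 : (Pi.single a 1 : Vec m n) = intVec (Pi.single a 1) := by
        funext i
        by_cases hi : i = a
        · subst hi; simp [intVec]
        · simp [intVec, hi]
      change φ (lin g (Pi.single a 1)) = 0
      rw [h4]
      exact h0 _ (mem_latticeOf.2 ⟨_, rfl⟩)
    refine hφ (LinearMap.ext fun w => ?_)
    have h5 := LinearMap.congr_fun h3 (lin g⁻¹ w)
    rw [← lin_lin_inv g w]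
    exact h5
  obtain ⟨l, hl, hc⟩ := hl
  obtain ⟨w, hw, rfl⟩ := exists_mem_hyperplane_F_eq N₁ N₂ hm hn hN₁ hN₂ hφ hc hr
  have hmem : w - l - v ∈ U := by
    rw [hker, LinearMap.mem_ker, map_sub, map_sub, hw, map_add]
    ring
  refine F_mem_closure_of_mem_orbitClosure N₁ N₂
    (h ⟨QuotientAddGroup.mk (v + (w - l - v)), ⟨_, hmem, rfl⟩, rfl⟩) ?_
  change (QuotientAddGroup.mk w : Torus (Lattice.of g)) = QuotientAddGroup.mk (v + (w - l - v))
  rw [QuotientAddGroup.eq]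
  have : -w + (v + (w - l - v)) = -l := by abel
  rw [this]
  exact neg_mem hl

end Values

end Grids

end


theorem theorem2 (m n : ℕ) (hm : 1 ≤ m) (hn : 1 ≤ n) (hmn : Nat.gcd m n = 1)
    (N₁ : Seminorm ℝ (Fin m → ℝ)) (hN₁ : ∀ v, N₁ v = 0 → v = 0)
    (N₂ : Seminorm ℝ (Fin n → ℝ)) (hN₂ : ∀ w, N₂ w = 0 → w = 0)
    (x : Grids.Lattice m n) (k : ℕ) (hk : k + 1 = m + n)
    (s : Fin (k + 1) → Grids.Lattice m n) (hs : Grids.IsAccumulationSequence x s)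
    (μ : MeasureTheory.Measure (Grids.Torus x)) (hμ : Grids.IsNontrivialAlgebraic x μ) :
    (∀ᵐ y ∂μ, Grids.IsDV N₁ N₂ (Grids.Torus.toGrid x y)) ∧
    (∀ᵐ y ∂μ, ∃ (U : Submodule ℝ (Grids.Vec m n)) (v : Grids.Vec m n),
      Grids.IsRational (s (Fin.last k)) U ∧ Module.finrank ℝ U = m + n - 1 ∧
        Grids.Torus.toGrid (s (Fin.last k)) '' Grids.coset (s (Fin.last k)) U v ⊆
          Grids.orbitClosure (Grids.Torus.toGrid x y)) := by
  have hbd : s ⟨1, by omega⟩ ∈ Grids.boundary x := by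
    have h := hs.2 ⟨0, by omega⟩
    rwa [show s (Fin.castSucc ⟨0, by omega⟩) = x from hs.1] at h
  have hae : ∀ᵐ y ∂μ, ∃ (U : Submodule ℝ (Grids.Vec m n)) (v : Grids.Vec m n),
      Grids.IsRational (s (Fin.last k)) U ∧ Module.finrank ℝ U = m + n - 1 ∧
        Grids.Torus.toGrid (s (Fin.last k)) '' Grids.coset (s (Fin.last k)) U v ⊆
          Grids.orbitClosure (Grids.Torus.toGrid x y) := by
    filter_upwards [Grids.ae_containsCoset_one hm hn hmn hbd hμ] with y hy
    obtain ⟨U, v, hU, hdim, hsub⟩ :=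
      (Grids.containsCoset_of_accumulation hmn hk hs (by omega) hy).exists_coset_subset
    exact ⟨U, v, hU, by omega, hsub⟩
  refine ⟨hae.mono ?_, hae⟩
  rintro y ⟨U, v, -, hU, hsub⟩
  exact Grids.isDV_of_coset_subset N₁ N₂ hm hn hN₁ hN₂ hU hsub
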